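/- Consider one secondary user $n$ in a cluster of $C$ users $1,\dots,C$ sharing a primary channel of bandwidth $W>0$, one of $K\ge 1$ primary channels. A slot has a broadcasting phase $i=s$ (a secondary base station transmits, the UAV $j=r$ receives) of relative duration $\lambda_s=\lambda\in(0,1)$ and a relaying phase $i=r$ (the UAV transmits, the user $j=n$ receives) of relative duration $\lambda_r=1-\lambda$. Let $\bar R>0$ be the target rate and $\bar\gamma_i=2^{\bar R/(\lambda_i W)}-1$. For each phase let $\bar P_i=P_i/K>0$ be the nominal transmit power, $\ell_i,\ell_{p,i},\ell_{k,i}>0$ the large-scale gains of the links transmitter–receiver, primary base station–receiver and transmitter–primary user, $v_{i,1},\dots,v_{i,C}\ge 0$ the power allocation factors, $h_i,h_{p,i}\ge0$ the hardware distortion powers of the first two of these links, $\epsilon_i\ge0$ the channel estimation error variance, $\sigma_i^2>0$ the noise variance, $\mathrm{ITC}>0$ the interference temperature threshold, $\varrho_{p,i}=P_p\ell_{p,i}/K>0$ the received power scale of the primary base station, and $x_i,y_i,z_i$ positive integers. In each phase let the power gains $X_i$ (estimated channel transmitter–receiver), $Y_i$ (fading transmitter–primary user) and $Z_i$ (fading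 primary base station–receiver) be the squared moduli of complex random channel coefficients, mutually independent, with the Nakagami-$m$ power densities $m^m t^{m-1}e^{-mt}/\Gamma(m)$, $t>0$, for $m=x_i,y_i,z_i$ respectively. The transmit power is $P=\bar P_i$ if $\bar P_i\ell_{k,i}Y_i\le \mathrm{ITC}$ and $P=\mathrm{ITC}/(\ell_{k,i}Y_i)$ otherwise. With $I_i=\sum_{m>n}v_{i,m}$ and $E_i=\epsilon_i(1+h_i)$, the signal-to-interference-distortion-noise ratio is $$\gamma_i=\frac{X_i v_{i,n}}{X_iI_i+X_ih_i+E_i+Z_i\frac{\varrho_{p,i}}{P\ell_i}(1+h_{p,i})+\frac{\sigma_i^2}{P\ell_i}} .$$ Assume $\mathcal A_i=v_{i,n}-I_i\bar\gamma_i-h_i\bar\gamma_i>0$. Put $T_i=\mathrm{ITC}/\ell_{k,i}$, $\Lambda=T_i/\bar P_i$, $$\mathcal I=\frac{\varrho_{p,i}(1+h_{p,i})\bar\gamma_i}{\bar P_i\ell_i\mathcal A_i},\quad \mathcal E=\frac{E_i\bar\gamma_i}{\mathcal A_i},\quad \mathcal S=\frac{\sigma_i^2\bar\gamma_i}{\bar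 P_i\ell_i\mathcal A_i},\quad \mathcal V=\frac{\sigma_i^2\bar\gamma_i}{T_i\ell_i\mathcal A_i},\quad \mathcal U=\frac{\varrho_{p,i}(1+h_{p,i})\bar\gamma_i}{T_i\ell_i\mathcal A_i},$$ and write $x,y,z$ for $x_i,y_i,z_i$ and $B=y+x\mathcal V$. Then, in each of the two phases, $$\Pr[\gamma_i\ge\bar\gamma_i]=1-\Pr[\gamma_i<\bar\gamma_i]=1-F_{\gamma_i}(\bar\gamma_i),$$ where the cumulative distribution function $F_{\gamma_i}$ of $\gamma_i$ satisfies $$\begin{aligned}F_{\gamma_i}(\bar\gamma_i)={}&\frac{\gamma_{inc}(y,y\Lambda)}{\Gamma(y)}-\frac{\gamma_{inc}(y,y\Lambda)}{\Gamma(y)}\frac{z^ze^{-x(\mathcal E+\mathcal S)}}{\Gamma(z)}\sum_{q=0}^{x-1}\frac{x^q}{q!}\sum_{l=0}^q\binom ql\frac{(\mathcal E+\mathcal S)^{q-l}\mathcal I^l\,\Gamma(z+l)}{(z+x\mathcal I)^{z+l}}+\frac{\Gamma(y,y\Lambda)}{\Gamma(y)}\\&-\frac{z^ze^{-\Lambda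 B}}{\Gamma(z)}\frac{y^ye^{-x\mathcal E}}{\mathcal U^z\Gamma(y)}\sum_{k=0}^{x-1}\frac{1}{k!}\sum_{j=0}^k\binom kj\mathcal E^{k-j}\sum_{u=0}^j\binom ju x^{k-z-u}\,\mathcal V^{j-u}\sum_{p=0}^{y+j-1}\frac{\Lambda^p}{p!}\sum_{t=0}^p\binom pt B^{p+u+z-j-y}\\&\qquad\times G^{2,1}_{1,2}\!\left(\frac{(z+x\Lambda\mathcal U)B}{x\,\mathcal U}\,\middle|\,{1-(z+u+t)\atop 0,\;y+j-z-u-t}\right).\end{aligned}$$ Here $0^0=1$, $\gamma_{inc}$ and $\Gamma(\cdot,\cdot)$ are the lower and upper incomplete gamma functions, and $G^{2,1}_{1,2}$ is the Meijer G-function. -/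

import Mathlib

open MeasureTheory ProbabilityTheory
open scoped BigOperators

noncomputable section

namespace CRNoma

/-! ### Special functions -/

/-- Lower incomplete gamma function `∫_0^x t^(a-1) e^(-t) dt`. -/
def lowerGamma (a x : ℝ) : ℝ := ∫ t in (0 : ℝ)..x, t ^ (a - 1) * Real.exp (-t)

/-- Upper incomplete gamma function `∫_x^∞ t^(a-1) e^(-t) dt`. -/
def upperGamma (a x : ℝ) : ℝ := ∫ t in Set.Ioi x, t ^ (a - 1) * Real.exp (-t)

/-- Mellin–Barnes integrand of the Meijer function `G^{m,n}_{p,q}` at `z`. The upper parameters are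
`a₁,…,aₙ` (in `a`) followed by `a_{n+1},…,a_p` (in `a'`), the lower parameters are `b₁,…,b_m` (in
`b`) followed by `b_{m+1},…,b_q` (in `b'`). -/
def meijerIntegrand {n p' m q' : ℕ} (a : Fin n → ℂ) (a' : Fin p' → ℂ) (b : Fin m → ℂ)
    (b' : Fin q' → ℂ) (z s : ℂ) : ℂ :=
  ((∏ j, Complex.Gamma (b j - s)) * ∏ j, Complex.Gamma (1 - a j + s)) /
    ((∏ j, Complex.Gamma (1 - b' j + s)) * ∏ j, Complex.Gamma (a' j - s)) * z ^ s

/-- The vertical line `Re s = c` separates the poles of the `Γ(b_j - s)` (on its right) from the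
poles of the `Γ(1 - a_j + s)` (on its left). -/
def MeijerSeparates {n m : ℕ} (a : Fin n → ℂ) (b : Fin m → ℂ) (c : ℝ) : Prop :=
  (∀ j, (a j).re - 1 < c) ∧ ∀ j, c < (b j).re

open Classical in
/-- Meijer's function `G^{m,n}_{p,q}` as the Mellin–Barnes integral `(2πi)⁻¹ ∫_L … ds` along an
upward vertical line `L` that separates the two families of poles. (The value does not depend on
the separating line; parameters for which only bent contours separate get the value `0`.) -/
def meijerG {n p' m q' : ℕ} (a : Fin n → ℂ) (a' : Fin p' → ℂ) (b : Fin m → ℂ) (b' : Fin q' → ℂ)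
    (z : ℂ) : ℂ :=
  if h : ∃ c : ℝ, MeijerSeparates a b c then
    (1 / (2 * Real.pi) : ℂ) *
      ∫ t : ℝ, meijerIntegrand a a' b b' z ((h.choose : ℂ) + (t : ℂ) * Complex.I)
  else 0

/-- `G^{2,1}_{1,2}(z | a₁ ; b₁, b₂)`. -/
def meijerG2112 (a₁ b₁ b₂ z : ℂ) : ℂ := meijerG ![a₁] ![] ![b₁, b₂] ![] z

/-! ### The network -/

/-- The two phases of a time slot: in `broadcast` the transmitter is the secondary base station and
the receiver is the UAV, in `relay` the transmitter is the UAV and the receiver is the considered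
secondary user. -/
inductive Phase
  | broadcast
  | relay

/-- The deterministic parameters that concern one secondary user of a cluster of `C` users sharing
one primary channel. Quantities indexed by a phase `i` refer to the transmitter `i` and the
receiver `j` of that phase; `p` is the primary base station and `k` the primary user. -/
structure Network (C : ℕ) where
  /-- number of primary channels -/
  K : ℕ
  K_pos : 0 < K
  /-- bandwidth of a channel -/
  W : ℝ
  W_pos : 0 < W
  /-- target rate -/
  Rbar : ℝ
  Rbar_pos : 0 < Rbar
  /-- fraction of the slot used by the broadcasting phase -/
  lam : ℝ
  lam_pos : 0 < lam
  lam_lt_one : lam < 1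
  /-- interference temperature threshold of the primary user -/
  ITC : ℝ
  ITC_pos : 0 < ITC
  /-- total power of the primary base station -/
  Pp : ℝ
  Pp_pos : 0 < Pp
  /-- total power of the transmitter -/
  Ptot : Phase → ℝ
  Ptot_pos : ∀ i, 0 < Ptot i
  /-- large-scale gain from the transmitter to the receiver -/
  ell : Phase → ℝ
  ell_pos : ∀ i, 0 < ell i
  /-- large-scale gain from the primary base station to the receiver -/
  ellp : Phase → ℝ
  ellp_pos : ∀ i, 0 < ellp i
  /-- large-scale gain from the transmitter to the primary user -/
  ellk : Phase → ℝ
  ellk_pos : ∀ i, 0 < ellk i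
  /-- power allocation factors `α` (broadcasting) and `β` (relaying) of the cluster members -/
  v : Phase → Fin C → ℝ
  v_nonneg : ∀ i m, 0 ≤ v i m
  /-- the considered user -/
  n : Fin C
  /-- hardware distortion noise power on the link from the transmitter to the receiver -/
  hi : Phase → ℝ
  hi_nonneg : ∀ i, 0 ≤ hi i
  /-- hardware distortion noise power on the link from the primary base station to the receiver -/
  hip : Phase → ℝ
  hip_nonneg : ∀ i, 0 ≤ hip i
  /-- variance of the channel estimation error -/
  err : Phase → ℝ
  err_nonneg : ∀ i, 0 ≤ err i
  /-- variance of the thermal noise at the receiver -/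
  noise : Phase → ℝ
  noise_pos : ∀ i, 0 < noise i
  /-- integer Nakagami parameter of the link from the transmitter to the receiver -/
  mX : Phase → ℕ
  mX_pos : ∀ i, 0 < mX i
  /-- integer Nakagami parameter of the link from the transmitter to the primary user -/
  mY : Phase → ℕ
  mY_pos : ∀ i, 0 < mY i
  /-- integer Nakagami parameter of the link from the primary base station to the receiver -/
  mZ : Phase → ℕ
  mZ_pos : ∀ i, 0 < mZ i

namespace Network

variable {C : ℕ} (N : Network C) (i : Phase)

/-- Fraction of the time slot used by a phase. -/
def fraction : Phase → ℝ
  | .broadcast => N.lam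
  | .relay => 1 - N.lam

/-- SIDNR threshold of a phase. -/
def thr : ℝ := 2 ^ (N.Rbar / (N.fraction i * N.W)) - 1

/-- Nominal transmit power on the channel. -/
def Pbar : ℝ := N.Ptot i / N.K

/-- Received interference scale `ϱ_p^j` of the primary base station. -/
def rhop : ℝ := N.Pp * N.ellp i / N.K

/-- Interference left by successive interference cancellation. -/
def Isic : ℝ := ∑ m ∈ Finset.Ioi N.n, N.v i m

/-- Channel error power. -/
def E : ℝ := N.err i * (1 + N.hi i)

/-- Transmit power when the small-scale power gain to the primary user is `y`, so that the
composite gain is `ellk * y`: the nominal power if it meets the interference temperature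
constraint, and otherwise the power that meets it with equality. -/
def txPower (y : ℝ) : ℝ :=
  if N.Pbar i * (N.ellk i * y) ≤ N.ITC then N.Pbar i else N.ITC / (N.ellk i * y)

/-- SIDNR for decoding the considered user's message at transmit power `P`, when `x` is the power
gain of the estimated channel and `z` the power gain from the primary base station. -/
def sidnrAt (P x z : ℝ) : ℝ :=
  x * N.v i N.n /
    (x * N.Isic i + x * N.hi i + N.E i
      + z * (N.rhop i / (P * N.ell i) * (1 + N.hip i)) + N.noise i / (P * N.ell i))

/-- SIDNR for decoding the considered user's message, given the coefficient `hx` of the estimated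
channel and the small-scale fading coefficients `hy` to the primary user and `hz` from the primary
base station. -/
def sidnr (hx hy hz : ℂ) : ℝ :=
  N.sidnrAt i (N.txPower i (‖hy‖ ^ 2)) (‖hx‖ ^ 2) (‖hz‖ ^ 2)

/-! ### The terms of the closed form -/

/-- Interference temperature threshold, referred to the unit-mean gain to the primary user. -/
def ITCn : ℝ := N.ITC / N.ellk i

def A : ℝ := N.v i N.n - N.Isic i * N.thr i - N.hi i * N.thr i

/-- `𝓘 = I_p γ̄ / 𝓐` with `I_p = (ϱ_p / ϱ) (1 + σ²)` and `ϱ = P̄ ℓ`. -/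
def calI : ℝ := N.rhop i / (N.Pbar i * N.ell i) * (1 + N.hip i) * N.thr i / N.A i

def calE : ℝ := N.E i * N.thr i / N.A i

def calS : ℝ := N.noise i / (N.Pbar i * N.ell i) * N.thr i / N.A i

def calV : ℝ := N.thr i * (N.noise i / (N.ITCn i * N.ell i)) / N.A i

def calU : ℝ := N.thr i * (N.rhop i / (N.ITCn i * N.ell i) * (1 + N.hip i)) / N.A i

def Lam : ℝ := N.ITCn i / N.Pbar i

/-- The part of the closed form in which the interference temperature constraint is inactive. -/
def closedInactive : ℝ :=
  let x := N.mX i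
  let y := N.mY i
  let z := N.mZ i
  lowerGamma y (y * N.Lam i) / Real.Gamma y
    - lowerGamma y (y * N.Lam i) / Real.Gamma y
      * ((z : ℝ) ^ z * Real.exp (-(x * (N.calE i + N.calS i))) / Real.Gamma z)
      * ∑ q ∈ Finset.range x, (x : ℝ) ^ q / (q.factorial : ℝ)
        * ∑ l ∈ Finset.range (q + 1), (q.choose l : ℝ)
          * ((N.calE i + N.calS i) ^ (q - l) * N.calI i ^ l * Real.Gamma ((z : ℝ) + l)
              / ((z : ℝ) + x * N.calI i) ^ (z + l))

/-- The part of the closed form in which the interference temperature constraint is active. -/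
def closedActive : ℂ :=
  let x := N.mX i
  let y := N.mY i
  let z := N.mZ i
  let B : ℝ := y + x * N.calV i
  ((upperGamma y (y * N.Lam i) / Real.Gamma y : ℝ) : ℂ)
    - (((z : ℝ) ^ z * Real.exp (-(N.Lam i * B)) / Real.Gamma z
        * ((y : ℝ) ^ y * Real.exp (-(x * N.calE i)) / (N.calU i ^ z * Real.Gamma y)) : ℝ) : ℂ)
      * ∑ k ∈ Finset.range x, ∑ j ∈ Finset.range (k + 1), ∑ u ∈ Finset.range (j + 1),
          ∑ p ∈ Finset.range (y + j), ∑ t ∈ Finset.range (p + 1),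
            (((x : ℝ) ^ ((k : ℤ) - z - u) / (k.factorial : ℝ)
              * (k.choose j : ℝ) * N.calE i ^ (k - j)
              * (j.choose u : ℝ) * N.calV i ^ (j - u)
              * (N.Lam i ^ p / (p.factorial : ℝ)) * (p.choose t : ℝ)
              * B ^ ((p : ℤ) + u + z - j - y) : ℝ) : ℂ)
            * meijerG2112 (1 - ((z : ℂ) + u + t)) 0 ((y : ℂ) + j - z - u - t)
                (((z + x * N.Lam i * N.calU i) / (x * N.calU i * B⁻¹) : ℝ) : ℂ)

/-- Closed form of the distribution function of the SIDNR at the threshold of the phase. -/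
def closedCDF : ℂ := (N.closedInactive i : ℂ) + N.closedActive i

end Network

/-- Nakagami fading with parameter `m`: the power gain is gamma distributed with density
`m ^ m * x ^ (m - 1) * exp (-m x) / Γ(m)` on `x ≥ 0`. -/
def IsNakagami {Ω : Type*} [MeasurableSpace Ω] (μ : Measure Ω) (h : Ω → ℂ) (m : ℕ) : Prop :=
  HasLaw (fun ω => ‖h ω‖ ^ 2) (gammaMeasure m m) μ

end CRNoma

end

noncomputable section

namespace CRNoma

/-! ### Mellin–Barnes representation of a Laplace-type integral -/

/-! Clearing the positive denominator of the SIDNR and collecting the terms in `X` turns `γ ≥ γ̄`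
into `X ≥ level(Y, Z)`, because `𝓐 > 0`. By independence, the success probability given `(Y, Z)` is
the tail of a gamma law of integer shape `x`, the finite sum `e^(-xw) ∑_{q<x} (xw)^q / q!` at `w =
level(Y, Z)`. It remains to average this over `(Y, Z)`.

For `Y ≤ Λ` the level is `(𝓔 + 𝓢) + 𝓘 Z`, free of `Y`: the average is the probability of `Y ≤ Λ`
times ordinary gamma integrals in `Z` (`integral_nakagamiDensity_mul_gammaTail`). For `Y > Λ` the
power is inversely proportional to `Y` and the level is `𝓔 + Y (𝓥 + 𝓤 Z)`. Integrating over `Y`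
first gives finite incomplete gamma sums with rate `B + x𝓤s` at `Z = s`; binomial expansions then
leave integrals of the type `∫ s^(a-1) e^(-Rs) (B + Ds)^(-b) ds`.

These are Meijer functions: `G(ζ) = Γ(b) ∫ w^(a-1) e^(-ζw) (1+w)^(-b) dw` for the parameters at hand
(`meijerG2112_eq_integral`). To see this, write the factor `Γ(-s) ζ^s` of the Mellin–Barnes
integrand as a Laplace-type integral in `v` and exchange the integrals. What remains inside is the
inverse Mellin transform of a beta integral.

The gamma laws have no atoms, so the strict and the weak decoding events have the same probability.
This identifies the distribution function at the threshold with one minus the success probability.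
-/

theorem norm_Gamma_le_Gamma_re {s : ℂ} (hs : 0 < s.re) : ‖Complex.Gamma s‖ ≤ Real.Gamma s.re := by
  rw [Complex.Gamma_eq_integral hs, Real.Gamma_eq_integral hs, Complex.GammaIntegral]
  refine (norm_integral_le_integral_norm _).trans (le_of_eq ?_)
  refine setIntegral_congr_fun measurableSet_Ioi fun t (ht : 0 < t) => ?_
  simp only [norm_mul, Complex.norm_cpow_eq_rpow_re_of_pos ht, Complex.norm_real, Real.norm_eq_abs,
    abs_of_pos (Real.exp_pos _), Complex.sub_re, Complex.one_re]

/-- The gamma quotients occurring in the beta integral are integrable along vertical lines. -/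
theorem integrable_Gamma_mul_Gamma {σ b : ℝ} (hσ : 0 < σ) (hσb : σ < b) :
    Integrable fun t : ℝ => Complex.Gamma (σ + t * Complex.I) *
      Complex.Gamma (b - (σ + t * Complex.I)) := by
  have hcont : Continuous fun t : ℝ => Complex.Gamma (σ + t * Complex.I) *
      Complex.Gamma (b - (σ + t * Complex.I)) := by
    refine continuous_iff_continuousAt.2 fun t => ContinuousAt.mul ?_ ?_
    · refine ContinuousAt.comp (f := fun t : ℝ => (σ + t * Complex.I : ℂ))
        (Complex.differentiableAt_Gamma _ fun m h => ?_).continuousAt (by fun_prop)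
      have := congrArg Complex.re h
      simp at this
      have : (0 : ℝ) ≤ m := m.cast_nonneg
      linarith
    · refine ContinuousAt.comp (f := fun t : ℝ => (b - (σ + t * Complex.I) : ℂ))
        (Complex.differentiableAt_Gamma _ fun m h => ?_).continuousAt (by fun_prop)
      have := congrArg Complex.re h
      simp at this
      have : (0 : ℝ) ≤ m := m.cast_nonneg
      linarith
  -- The majorant is a constant times `‖s‖⁻²`: two uses of the functional equation give `‖Γ(s)‖ ‖s‖
  -- ‖s + 1‖ = ‖Γ(s + 2)‖ ≤ Γ(σ + 2)`, and `‖s‖ ≤ ‖s + 1‖`.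
  have hdom : Integrable fun t : ℝ =>
      Real.Gamma (σ + 2) * Real.Gamma (b - σ) * (σ ^ 2)⁻¹ * (1 + (σ⁻¹ * t) ^ 2)⁻¹ :=
    (integrable_inv_one_add_sq.comp_mul_left' (inv_ne_zero hσ.ne')).const_mul _
  refine hdom.mono' hcont.aestronglyMeasurable (Filter.Eventually.of_forall fun t => ?_)
  set s : ℂ := σ + t * Complex.I with hs
  have hre : s.re = σ := by simp [hs]
  have him : s.im = t := by simp [hs]
  have hs0 : s ≠ 0 := fun h => by rw [h] at hre; simp at hre; linarith
  have hs1 : s + 1 ≠ 0 := fun h => by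
    have := congrArg Complex.re h
    simp [hre] at this
    linarith
  have h2 : Complex.Gamma (s + 2) = (s + 1) * (s * Complex.Gamma s) := by
    rw [← Complex.Gamma_add_one s hs0, ← Complex.Gamma_add_one (s + 1) hs1]
    congr 1; ring
  have hG1 : ‖Complex.Gamma (s + 2)‖ ≤ Real.Gamma (σ + 2) := by
    have := norm_Gamma_le_Gamma_re (s := s + 2) (by simp [hre]; linarith)
    simpa [hre] using this
  have hG2 : ‖Complex.Gamma (b - s)‖ ≤ Real.Gamma (b - σ) := by
    have := norm_Gamma_le_Gamma_re (s := b - s) (by simp [hre]; linarith)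
    simpa [hre] using this
  have hn0 : ‖s‖ ^ 2 = σ ^ 2 + t ^ 2 := by
    rw [Complex.sq_norm, Complex.normSq_apply, hre, him]; ring
  have hn1 : ‖s‖ ≤ ‖s + 1‖ := by
    refine le_of_sq_le_sq ?_ (norm_nonneg _)
    rw [hn0, Complex.sq_norm, Complex.normSq_apply]
    simp only [Complex.add_re, Complex.add_im, Complex.one_re, Complex.one_im, hre, him]
    nlinarith
  have hpos : 0 < ‖s‖ := norm_pos_iff.2 hs0
  have hGs : ‖Complex.Gamma s‖ * ‖s‖ ^ 2 ≤ Real.Gamma (σ + 2) := by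
    refine le_trans ?_ hG1
    rw [h2, norm_mul, norm_mul]
    nlinarith [mul_nonneg (norm_nonneg s) (norm_nonneg (Complex.Gamma s))]
  have hGs' : ‖Complex.Gamma s‖ ≤ Real.Gamma (σ + 2) * (‖s‖ ^ 2)⁻¹ := by
    rw [← div_eq_mul_inv, le_div_iff₀ (by positivity)]; exact hGs
  have hden : (σ ^ 2)⁻¹ * (1 + (σ⁻¹ * t) ^ 2)⁻¹ = (‖s‖ ^ 2)⁻¹ := by
    rw [hn0, ← mul_inv]; congr 1; field_simp
  rw [norm_mul, mul_assoc _ (σ ^ 2)⁻¹, hden]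
  calc _ ≤ Real.Gamma (σ + 2) * (‖s‖ ^ 2)⁻¹ * Real.Gamma (b - σ) :=
        mul_le_mul hGs' hG2 (norm_nonneg _) ((norm_nonneg _).trans hGs')
    _ = _ := by ring

/-- This licenses Fubini in Euler's beta integral. In absolute value, integrating over `w` first
leaves `Γ(Re s) v^(b - Re s - 1) e^(-v)`, which is integrable exactly because `Re s < b`. -/
theorem integrable_betaKernel {s : ℂ} {b : ℕ} (hs : 0 < s.re) (hsb : s.re < b) :
    Integrable (fun p : ℝ × ℝ => (p.1 : ℂ) ^ (s - 1) *
      ((p.2 : ℂ) ^ ((b : ℂ) - 1) * Complex.exp (-((1 + p.1 : ℝ) * p.2))))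
      ((volume.restrict (Set.Ioi 0)).prod (volume.restrict (Set.Ioi 0))) := by
  have hb : (0 : ℝ) < b := hs.trans hsb
  have hmeas : Measurable (fun p : ℝ × ℝ => (p.1 : ℂ) ^ (s - 1) *
      ((p.2 : ℂ) ^ ((b : ℂ) - 1) * Complex.exp (-((1 + p.1 : ℝ) * p.2)))) := by
    fun_prop
  have hnorm : ∀ w v : ℝ, 0 < w → 0 < v → ‖(w : ℂ) ^ (s - 1) *
      ((v : ℂ) ^ ((b : ℂ) - 1) * Complex.exp (-((1 + w : ℝ) * v)))‖ =
      (v ^ ((b : ℝ) - 1) * Real.exp (-v)) * (w ^ (s.re - 1) * Real.exp (-(v * w))) := by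
    intro w v hw hv
    have h1 : Complex.exp (-((1 + w : ℝ) * v)) = ((Real.exp (-v) * Real.exp (-(v * w)) : ℝ) : ℂ) := by
      rw [← Real.exp_add]; push_cast; congr 1; ring
    rw [h1, norm_mul, norm_mul, Complex.norm_cpow_eq_rpow_re_of_pos hw,
      Complex.norm_cpow_eq_rpow_re_of_pos hv, Complex.norm_real, Real.norm_eq_abs,
      abs_of_pos (by positivity)]
    simp
    ring
  have hin : ∀ v : ℝ, 0 < v → IntegrableOn (fun w : ℝ => (v ^ ((b : ℝ) - 1) * Real.exp (-v)) *
      (w ^ (s.re - 1) * Real.exp (-(v * w)))) (Set.Ioi 0) := fun v hv => by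
    refine Integrable.const_mul ?_ _
    -- The integral of a non-integrable function is `0` by convention, so a known nonzero value
    -- proves integrability.
    refine Integrable.of_integral_ne_zero ?_
    rw [Real.integral_rpow_mul_exp_neg_mul_Ioi hs hv]
    have := Real.Gamma_pos_of_pos hs
    positivity
  rw [integrable_prod_iff' hmeas.aestronglyMeasurable]
  constructor
  · filter_upwards [ae_restrict_mem measurableSet_Ioi] with v (hv : 0 < v)
    refine (integrable_norm_iff (by fun_prop)).1 ?_
    refine (hin v hv).congr ?_
    filter_upwards [ae_restrict_mem measurableSet_Ioi] with w (hw : 0 < w)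
    exact (hnorm w v hw hv).symm
  · have : IntegrableOn (fun v : ℝ => Real.Gamma s.re *
        (v ^ ((b : ℝ) - s.re - 1) * Real.exp (-(1 * v)))) (Set.Ioi 0) := by
      refine Integrable.const_mul ?_ _
      refine Integrable.of_integral_ne_zero ?_
      rw [Real.integral_rpow_mul_exp_neg_mul_Ioi (by linarith) one_pos]
      have := Real.Gamma_pos_of_pos (s := (b : ℝ) - s.re) (by linarith)
      positivity
    refine this.congr ?_
    filter_upwards [ae_restrict_mem measurableSet_Ioi] with v (hv : 0 < v)
    have : ∫ w in Set.Ioi (0 : ℝ), ‖(w : ℂ) ^ (s - 1) *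
        ((v : ℂ) ^ ((b : ℂ) - 1) * Complex.exp (-((1 + w : ℝ) * v)))‖ =
        (v ^ ((b : ℝ) - 1) * Real.exp (-v)) * ((1 / v) ^ s.re * Real.Gamma s.re) := by
      rw [← Real.integral_rpow_mul_exp_neg_mul_Ioi hs hv, ← integral_const_mul]
      exact setIntegral_congr_fun measurableSet_Ioi fun w hw => hnorm w v hw hv
    rw [this, one_div, Real.inv_rpow hv.le, ← Real.rpow_neg hv.le, one_mul,
      show (b : ℝ) - s.re - 1 = ((b : ℝ) - 1) + (-s.re) by ring, Real.rpow_add hv]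
    ring

theorem integral_betaKernel {b : ℕ} (hb : 0 < b) (s : ℂ) {w : ℝ} (hw : 0 < w) :
    ∫ v in Set.Ioi (0 : ℝ), (w : ℂ) ^ (s - 1) *
      ((v : ℂ) ^ ((b : ℂ) - 1) * Complex.exp (-((1 + w : ℝ) * v))) =
    Complex.Gamma b * ((w : ℂ) ^ (s - 1) • (((1 + w) ^ b)⁻¹ : ℂ)) := by
  rw [integral_const_mul, Complex.integral_cpow_mul_exp_neg_mul_Ioi (by simpa using hb)
    (by linarith : 0 < 1 + w)]
  rw [Complex.cpow_natCast, smul_eq_mul]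
  push_cast
  rw [one_div, inv_pow]
  ring

/-- Up to the factor `Γ(b)`, the integrand is a marginal of the integrable beta kernel. -/
theorem mellinConvergent_inv_one_add_pow {s : ℂ} {b : ℕ} (hs : 0 < s.re) (hsb : s.re < b) :
    MellinConvergent (fun w : ℝ => (((1 + w) ^ b)⁻¹ : ℂ)) s := by
  have hb : 0 < b := by exact_mod_cast hs.trans hsb
  have hG : Complex.Gamma b ≠ 0 := Complex.Gamma_ne_zero_of_re_pos (by simpa using hb)
  have h := ((integrable_betaKernel hs hsb).integral_prod_left).const_mul (Complex.Gamma b)⁻¹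
  refine h.congr ?_
  filter_upwards [ae_restrict_mem measurableSet_Ioi] with w (hw : 0 < w)
  rw [integral_betaKernel hb s hw, inv_mul_cancel_left₀ hG]

/-- Euler's beta integral on the half line. -/
theorem Gamma_mul_mellin_inv_one_add_pow {s : ℂ} {b : ℕ} (hs : 0 < s.re) (hsb : s.re < b) :
    Complex.Gamma b * mellin (fun w : ℝ => (((1 + w) ^ b)⁻¹ : ℂ)) s =
      Complex.Gamma s * Complex.Gamma (b - s) := by
  have hb : 0 < b := by exact_mod_cast hs.trans hsb
  rw [mellin, ← integral_const_mul, ← setIntegral_congr_fun measurableSet_Ioi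
    (fun w hw => integral_betaKernel hb s hw), integral_integral_swap (integrable_betaKernel hs hsb)]
  have hbs : 0 < ((b : ℂ) - s).re := by simpa using hsb
  have : ∀ v ∈ Set.Ioi (0 : ℝ), ∫ w in Set.Ioi (0 : ℝ), (w : ℂ) ^ (s - 1) *
      ((v : ℂ) ^ ((b : ℂ) - 1) * Complex.exp (-((1 + w : ℝ) * v))) =
      Complex.Gamma s * ((v : ℂ) ^ ((b : ℂ) - s - 1) * Complex.exp (-((1 : ℝ) * v))) := by
    intro v (hv : 0 < v)
    have hv' : (v : ℂ) ≠ 0 := by exact_mod_cast hv.ne'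
    have h1 : ∀ w : ℝ, (w : ℂ) ^ (s - 1) *
      ((v : ℂ) ^ ((b : ℂ) - 1) * Complex.exp (-((1 + w : ℝ) * v))) =
      ((v : ℂ) ^ ((b : ℂ) - 1) * Complex.exp (-v)) *
        ((w : ℂ) ^ (s - 1) * Complex.exp (-(v * w))) := fun w => by
      rw [show -(((1 + w : ℝ) : ℂ) * v) = -v + -(v * w) by push_cast; ring, Complex.exp_add]
      ring
    simp_rw [h1]
    rw [integral_const_mul, Complex.integral_cpow_mul_exp_neg_mul_Ioi hs hv, one_div,
      Complex.inv_cpow _ _ (by rw [Complex.arg_ofReal_of_nonneg hv.le]; exact Real.pi_pos.ne),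
      ← Complex.cpow_neg, show (b : ℂ) - s - 1 = ((b : ℂ) - 1) + (-s) by ring,
      Complex.cpow_add _ _ hv']
    push_cast
    rw [one_mul]
    ring
  rw [setIntegral_congr_fun measurableSet_Ioi this, integral_const_mul,
    Complex.integral_cpow_mul_exp_neg_mul_Ioi hbs one_pos]
  simp

/-- Mellin inversion of `Γ(b) w^a (1+w)^(-b)`, whose transform is `Γ(a+s) Γ(b-a-s)`. The bounds on
`c` place the line inside the strip of convergence. -/
theorem integral_Gamma_mul_Gamma_mul_cpow {a b : ℕ} {c : ℝ} (hac : -(a : ℝ) < c)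
    (hcb : c < (b : ℝ) - a) {v : ℝ} (hv : 0 < v) :
    (1 / (2 * Real.pi) : ℂ) * ∫ t : ℝ, (v : ℂ) ^ (-(c + t * Complex.I) : ℂ) *
      (Complex.Gamma ((b : ℂ) - a - (c + t * Complex.I)) *
        Complex.Gamma (a + (c + t * Complex.I))) =
      Complex.Gamma b * ((v : ℂ) ^ a * (((1 + v) ^ b)⁻¹ : ℂ)) := by
  set f : ℝ → ℂ := fun w => Complex.Gamma b • ((w : ℂ) ^ (a : ℂ) • (((1 + w) ^ b)⁻¹ : ℂ)) with hf
  have hmel : ∀ t : ℝ, mellin f (c + t * Complex.I) =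
      Complex.Gamma ((b : ℂ) - a - (c + t * Complex.I)) *
        Complex.Gamma (a + (c + t * Complex.I)) := fun t => by
    rw [hf, mellin_const_smul, mellin_cpow_smul, smul_eq_mul, Gamma_mul_mellin_inv_one_add_pow,
      mul_comm]
    · congr 2 <;> ring
    · simp; linarith
    · simp; linarith
  have hconv : MellinConvergent f c := by
    refine MellinConvergent.const_smul (MellinConvergent.cpow_smul.2 ?_) _
    refine mellinConvergent_inv_one_add_pow ?_ ?_ <;> simp <;> linarith
  have hint : Complex.VerticalIntegrable (mellin f) c := by
    have := integrable_Gamma_mul_Gamma (σ := a + c) (b := b) (by linarith) (by linarith)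
    refine this.congr (Filter.Eventually.of_forall fun t => ?_)
    simp only [hmel]
    rw [mul_comm]
    push_cast
    congr 2 <;> ring
  have hca : ContinuousAt f v := by
    have hden : ContinuousAt (fun w : ℝ => (1 + (w : ℂ)) ^ b) v := by fun_prop
    have hden0 : (1 + (v : ℂ)) ^ b ≠ 0 := by exact_mod_cast (by positivity : ((1 + v) ^ b) ≠ 0)
    exact ((Complex.continuousAt_ofReal_cpow_const v (a : ℂ) (Or.inr hv.ne')).smul
      (hden.inv₀ hden0)).const_smul (Complex.Gamma b)
  have h := mellinInv_mellin_eq c f hv hconv hint hca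
  simp only [mellinInv, hmel, smul_eq_mul] at h
  rw [hf] at h
  simp only [smul_eq_mul, Complex.cpow_natCast] at h
  rw [← h, Complex.real_smul]
  push_cast
  rfl

theorem integrableOn_rpow_mul_exp_neg_mul {r n : ℝ} (hr : 0 < r) (hn : 0 < n) :
    IntegrableOn (fun t : ℝ => t ^ (n - 1) * Real.exp (-(r * t))) (Set.Ioi 0) := by
  refine Integrable.of_integral_ne_zero ?_
  rw [Real.integral_rpow_mul_exp_neg_mul_Ioi hn hr]
  have := Real.Gamma_pos_of_pos hn
  positivity

/-- The Meijer function `G^{2,1}_{1,2}` with integer parameters as a Laplace-type integral. -/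
theorem meijerG2112_eq_integral {a b : ℕ} (ha : 0 < a) (hb : 0 < b) {ζ : ℝ} (hζ : 0 < ζ) :
    meijerG2112 (1 - (a : ℂ)) 0 ((b : ℂ) - a) ζ =
      ((Real.Gamma b * ∫ w in Set.Ioi (0 : ℝ), w ^ (a - 1) * Real.exp (-(ζ * w)) * ((1 + w) ^ b)⁻¹ : ℝ) : ℂ) := by
  have ha' : (0 : ℝ) < a := by exact_mod_cast ha
  have hb' : (0 : ℝ) < b := by exact_mod_cast hb
  have hex : ∃ c : ℝ, MeijerSeparates ![1 - (a : ℂ)] ![0, (b : ℂ) - a] c := by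
    obtain ⟨c, h1, h2⟩ := exists_between (a₁ := -(a : ℝ)) (a₂ := min 0 ((b : ℝ) - a))
      (lt_min (by linarith) (by linarith))
    refine ⟨c, ?_, ?_⟩
    · simpa [Fin.forall_fin_one] using h1
    · simpa [Fin.forall_fin_two] using lt_min_iff.1 h2
  rw [meijerG2112, meijerG, dif_pos hex]
  obtain ⟨h1, h2⟩ := hex.choose_spec
  set c : ℝ := hex.choose
  have hac : -(a : ℝ) < c := by simpa [Fin.forall_fin_one] using h1
  obtain ⟨hc0, hcb⟩ : c < 0 ∧ c < (b : ℝ) - a := by simpa [Fin.forall_fin_two] using h2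
  set Φ : ℝ → ℂ := fun t => Complex.Gamma ((b : ℂ) - a - (c + t * Complex.I)) *
        Complex.Gamma (a + (c + t * Complex.I)) with hΦ
  have hΦint : Integrable Φ := by
    have := integrable_Gamma_mul_Gamma (σ := a + c) (b := b) (by linarith) (by linarith)
    refine this.congr (Filter.Eventually.of_forall fun t => ?_)
    simp only [hΦ]
    rw [mul_comm]
    push_cast
    congr 2 <;> ring
  have hζ' : (ζ : ℂ) ≠ 0 := by exact_mod_cast hζ.ne'
  -- The lower parameter `0` forces `c < 0`, so `Γ(-s) ζ^s = ∫ v^(-s-1) e^(-ζv) dv` holds along the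
  -- whole line.
  have hkernel : ∀ t : ℝ, meijerIntegrand ![1 - (a : ℂ)] ![] ![0, (b : ℂ) - a] ![] ζ
      (c + t * Complex.I) = ∫ v in Set.Ioi (0 : ℝ),
        ((v : ℂ) ^ (-(c + t * Complex.I) - 1 : ℂ) * Complex.exp (-(ζ * v))) * Φ t := fun t => by
    rw [integral_mul_const, Complex.integral_cpow_mul_exp_neg_mul_Ioi (by simpa using hc0) hζ,
      one_div, Complex.inv_cpow _ _ (by rw [Complex.arg_ofReal_of_nonneg hζ.le]; exact Real.pi_pos.ne),
      ← Complex.cpow_neg, neg_neg]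
    simp [meijerIntegrand, hΦ]
    ring
  have hprod : Integrable (fun p : ℝ × ℝ =>
      ((p.2 : ℂ) ^ (-(c + p.1 * Complex.I) - 1 : ℂ) * Complex.exp (-(ζ * p.2))) * Φ p.1)
      (volume.prod (volume.restrict (Set.Ioi 0))) := by
    have hI := hΦint.norm.mul_prod (integrableOn_rpow_mul_exp_neg_mul hζ (n := -c) (by linarith))
    refine hI.mono' ?_ ?_
    · have : Measurable fun p : ℝ × ℝ =>
        ((p.2 : ℂ) ^ (-(c + p.1 * Complex.I) - 1 : ℂ) * Complex.exp (-(ζ * p.2))) := by fun_prop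
      exact this.aestronglyMeasurable.mul hΦint.aestronglyMeasurable.comp_fst
    · have : ∀ᵐ p : ℝ × ℝ ∂(volume.prod (volume.restrict (Set.Ioi 0))), 0 < p.2 :=
        Measure.quasiMeasurePreserving_snd.ae (ae_restrict_mem measurableSet_Ioi)
      filter_upwards [this] with p hp
      rw [norm_mul, norm_mul, Complex.norm_cpow_eq_rpow_re_of_pos hp, Complex.norm_exp, mul_comm]
      simp
  simp_rw [hkernel]
  rw [integral_integral_swap hprod, ← integral_const_mul]
  -- The integral over the line is the inverse Mellin transform above; the spare `v⁻¹` lowers `v^a`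
  -- to `v^(a-1)`.
  have hv : ∀ v ∈ Set.Ioi (0 : ℝ), (1 / (2 * Real.pi) : ℂ) * ∫ t : ℝ,
      ((v : ℂ) ^ (-(c + t * Complex.I) - 1 : ℂ) * Complex.exp (-(ζ * v))) * Φ t =
      ((Real.Gamma b * (v ^ (a - 1) * Real.exp (-(ζ * v)) * ((1 + v) ^ b)⁻¹) : ℝ) : ℂ) := by
    intro v (hv : 0 < v)
    have hv' : (v : ℂ) ≠ 0 := by exact_mod_cast hv.ne'
    have h1 : ∀ t : ℝ, ((v : ℂ) ^ (-(c + t * Complex.I) - 1 : ℂ) * Complex.exp (-(ζ * v))) * Φ t =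
        ((v : ℂ)⁻¹ * Complex.exp (-(ζ * v))) * ((v : ℂ) ^ (-(c + t * Complex.I) : ℂ) * Φ t) :=
      fun t => by rw [Complex.cpow_sub _ _ hv', Complex.cpow_one]; ring
    simp_rw [h1]
    rw [integral_const_mul, mul_left_comm, hΦ, integral_Gamma_mul_Gamma_mul_cpow hac hcb hv,
      ← Complex.ofReal_natCast b, Complex.Gamma_ofReal]
    obtain ⟨k, rfl⟩ := Nat.exists_eq_succ_of_ne_zero ha.ne'
    simp only [Nat.succ_eq_add_one, Nat.add_sub_cancel]
    push_cast
    field_simp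
    ring
  rw [setIntegral_congr_fun measurableSet_Ioi hv, integral_complex_ofReal, integral_const_mul]

/-! ### Gamma distributions with integer shape -/

/-- The derivative telescopes: differentiating each power cancels the preceding term of the sum, and
only the top term survives. -/
theorem hasDerivAt_exp_neg_mul_sum (n : ℕ) (u : ℝ) :
    HasDerivAt (fun u : ℝ => Real.exp (-u) * ∑ q ∈ Finset.range (n + 1), u ^ q / (q.factorial : ℝ))
      (-(Real.exp (-u) * (u ^ n / (n.factorial : ℝ)))) u := by
  induction n with
  | zero =>
    have := (hasDerivAt_neg u).exp
    simpa using this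
  | succ n ih =>
    have h := (hasDerivAt_neg u).exp.mul ((hasDerivAt_pow (n + 1) u).div_const ((n + 1).factorial : ℝ))
    have h2 := ih.add h
    have hf : (fun u : ℝ => Real.exp (-u) * ∑ q ∈ Finset.range (n + 1 + 1), u ^ q / (q.factorial : ℝ)) =
        (fun u : ℝ => Real.exp (-u) * ∑ q ∈ Finset.range (n + 1), u ^ q / (q.factorial : ℝ)) +
        (fun u : ℝ => Real.exp (-u)) * (fun u : ℝ => u ^ (n + 1) / ((n + 1).factorial : ℝ)) := by
      funext u
      rw [Finset.sum_range_succ, mul_add]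
      rfl
    rw [hf]
    refine h2.congr_deriv ?_
    rw [Nat.factorial_succ]
    push_cast
    have : (n.factorial : ℝ) ≠ 0 := by positivity
    field_simp
    ring

theorem tendsto_exp_neg_mul_sum (n : ℕ) :
    Filter.Tendsto (fun u : ℝ => Real.exp (-u) * ∑ q ∈ Finset.range n, u ^ q / (q.factorial : ℝ))
      Filter.atTop (nhds 0) := by
  have : Filter.Tendsto (fun u : ℝ => ∑ q ∈ Finset.range n, (u ^ q * Real.exp (-u)) / (q.factorial : ℝ))
      Filter.atTop (nhds (∑ q ∈ Finset.range n, 0 / (q.factorial : ℝ))) :=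
    tendsto_finsetSum _ fun q _ =>
      (Real.tendsto_pow_mul_exp_neg_atTop_nhds_zero q).div_const _
  simp only [zero_div, Finset.sum_const_zero] at this
  refine this.congr fun u => ?_
  rw [Finset.mul_sum]
  exact Finset.sum_congr rfl fun q _ => by ring

theorem hasDerivAt_upperGamma_antideriv (n : ℕ) {r : ℝ} (hr : 0 < r) (t : ℝ) :
    HasDerivAt (fun t : ℝ => -((n.factorial : ℝ) / r ^ (n + 1) * (Real.exp (-(r * t)) *
      ∑ q ∈ Finset.range (n + 1), (r * t) ^ q / (q.factorial : ℝ)))) (t ^ n * Real.exp (-(r * t))) t := by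
  have h := (((hasDerivAt_exp_neg_mul_sum n (r * t)).comp t ((hasDerivAt_id t).const_mul r)).const_mul
    ((n.factorial : ℝ) / r ^ (n + 1))).neg
  refine h.congr_deriv ?_
  have : (n.factorial : ℝ) ≠ 0 := by positivity
  rw [mul_pow]
  field_simp
  ring

theorem tendsto_upperGamma_antideriv (n : ℕ) {r : ℝ} (hr : 0 < r) :
    Filter.Tendsto (fun t : ℝ => -((n.factorial : ℝ) / r ^ (n + 1) * (Real.exp (-(r * t)) *
      ∑ q ∈ Finset.range (n + 1), (r * t) ^ q / (q.factorial : ℝ)))) Filter.atTop (nhds 0) := by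
  have h := (((tendsto_exp_neg_mul_sum (n + 1)).comp (Filter.tendsto_id.const_mul_atTop hr)).const_mul
    ((n.factorial : ℝ) / r ^ (n + 1))).neg
  simpa [Function.comp_def] using h

theorem integrableOn_pow_mul_exp_neg_mul_Ioi (n : ℕ) {r w : ℝ} (hr : 0 < r) (hw : 0 ≤ w) :
    IntegrableOn (fun t : ℝ => t ^ n * Real.exp (-(r * t))) (Set.Ioi w) :=
  integrableOn_Ioi_deriv_of_nonneg' (fun t _ => hasDerivAt_upperGamma_antideriv n hr t)
    (fun t ht => by have : 0 < t := hw.trans_lt ht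
                    positivity) (tendsto_upperGamma_antideriv n hr)

theorem integral_pow_mul_exp_neg_mul_Ioi (n : ℕ) {r w : ℝ} (hr : 0 < r) (hw : 0 ≤ w) :
    ∫ t in Set.Ioi w, t ^ n * Real.exp (-(r * t)) = (n.factorial : ℝ) / r ^ (n + 1) *
      (Real.exp (-(r * w)) * ∑ q ∈ Finset.range (n + 1), (r * w) ^ q / (q.factorial : ℝ)) := by
  rw [integral_Ioi_of_hasDerivAt_of_tendsto' (fun t _ => hasDerivAt_upperGamma_antideriv n hr t)
    (integrableOn_pow_mul_exp_neg_mul_Ioi n hr hw) (tendsto_upperGamma_antideriv n hr)]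
  ring

theorem measurable_gammaPDF (a r : ℝ) : Measurable (gammaPDF a r) :=
  (measurable_gammaPDFReal a r).ennreal_ofReal

/-- Density on `(0, ∞)` of the gamma distribution with integer shape and unit mean. -/
def nakagamiDensity (m : ℕ) (t : ℝ) : ℝ :=
  (m : ℝ) ^ m / Real.Gamma m * t ^ (m - 1) * Real.exp (-(m * t))

/-- Tail function on `[0, ∞)` of the gamma distribution with integer shape and unit mean. -/
def gammaTail (m : ℕ) (w : ℝ) : ℝ :=
  Real.exp (-(m * w)) * ∑ q ∈ Finset.range m, (m * w) ^ q / (q.factorial : ℝ)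

theorem continuous_gammaTail (m : ℕ) : Continuous (gammaTail m) := by
  unfold gammaTail
  fun_prop

theorem gammaPDFReal_eq_nakagamiDensity {m : ℕ} (hm : 0 < m) {t : ℝ} (ht : 0 ≤ t) :
    gammaPDFReal m m t = nakagamiDensity m t := by
  rw [gammaPDFReal, if_pos ht, nakagamiDensity, Real.rpow_natCast]
  congr 2
  rw [← Nat.cast_one, ← Nat.cast_sub hm, Real.rpow_natCast]

theorem isProbabilityMeasure_gammaMeasure_nat {m : ℕ} (hm : 0 < m) :
    IsProbabilityMeasure (gammaMeasure m m) :=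
  isProbabilityMeasure_gammaMeasure (by exact_mod_cast hm) (by exact_mod_cast hm)

theorem gammaMeasure_absolutelyContinuous (a r : ℝ) : gammaMeasure a r ≪ volume :=
  withDensity_absolutelyContinuous _ _

theorem gammaMeasure_Ioi_zero_ae {m : ℕ} : ∀ᵐ t ∂gammaMeasure m m, 0 < t := by
  have h0 : ∀ᵐ t ∂gammaMeasure m m, t ≠ 0 :=
    (gammaMeasure_absolutelyContinuous _ _).ae_le (Measure.ae_ne volume 0)
  have h1 : ∀ᵐ t ∂gammaMeasure m m, 0 ≤ t := by
    rw [gammaMeasure, ae_withDensity_iff (measurable_gammaPDF _ _)]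
    refine Filter.Eventually.of_forall fun t ht => ?_
    by_contra h
    exact ht (gammaPDF_of_neg (not_le.1 h))
  filter_upwards [h0, h1] with t h0 h1 using lt_of_le_of_ne h1 (Ne.symm h0)

theorem setIntegral_gammaMeasure {m : ℕ} (hm : 0 < m) (f : ℝ → ℝ) {w : ℝ} (hw : 0 ≤ w) :
    ∫ t in Set.Ioi w, f t ∂gammaMeasure m m = ∫ t in Set.Ioi w, nakagamiDensity m t * f t := by
  have hm' : (0 : ℝ) < m := by exact_mod_cast hm
  rw [gammaMeasure, restrict_withDensity measurableSet_Ioi,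
    integral_withDensity_eq_integral_toReal_smul
      (measurable_gammaPDF _ _) (by simp [gammaPDF])]
  refine setIntegral_congr_fun measurableSet_Ioi fun t ht => ?_
  have ht : 0 ≤ t := hw.trans (le_of_lt ht)
  simp only [gammaPDF]
  rw [ENNReal.toReal_ofReal (gammaPDFReal_nonneg hm' hm' t),
    gammaPDFReal_eq_nakagamiDensity hm ht, smul_eq_mul]

theorem integral_gammaMeasure {m : ℕ} (hm : 0 < m) (f : ℝ → ℝ) :
    ∫ t, f t ∂gammaMeasure m m = ∫ t in Set.Ioi 0, nakagamiDensity m t * f t := by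
  rw [← setIntegral_gammaMeasure hm f le_rfl, Measure.restrict_eq_self_of_ae_mem]
  exact gammaMeasure_Ioi_zero_ae

theorem gammaMeasure_real_Ioi {m : ℕ} (hm : 0 < m) {w : ℝ} (hw : 0 ≤ w) :
    (gammaMeasure m m).real (Set.Ioi w) = gammaTail m w := by
  have hm' : (0 : ℝ) < m := by exact_mod_cast hm
  have h := setIntegral_gammaMeasure hm (fun _ => 1) hw
  simp only [integral_const, MeasurableSet.univ, measureReal_restrict_apply, Set.univ_inter,
    smul_eq_mul, mul_one] at h
  rw [h]
  simp only [nakagamiDensity, mul_assoc]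
  rw [integral_const_mul, integral_pow_mul_exp_neg_mul_Ioi _ hm' hw, gammaTail]
  obtain ⟨k, rfl⟩ := Nat.exists_eq_succ_of_ne_zero hm.ne'
  simp only [Nat.succ_eq_add_one, Nat.add_sub_cancel, Nat.cast_add, Nat.cast_one,
    Real.Gamma_nat_eq_factorial]
  have : (k.factorial : ℝ) ≠ 0 := by positivity
  have : ((k : ℝ) + 1) ≠ 0 := by positivity
  field_simp

/-- Absence of atoms; this is what makes the strict and weak decoding events equally likely. -/
theorem gammaMeasure_Ici_eq_Ioi (a r w : ℝ) :
    (gammaMeasure a r) (Set.Ici w) = (gammaMeasure a r) (Set.Ioi w) := by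
  refine measure_congr ?_
  exact (gammaMeasure_absolutelyContinuous a r).ae_le Ioi_ae_eq_Ici.symm

theorem gammaTail_nonneg (m : ℕ) {w : ℝ} (hw : 0 ≤ w) : 0 ≤ gammaTail m w := by
  unfold gammaTail
  positivity

theorem gammaTail_le_one {m : ℕ} (hm : 0 < m) {w : ℝ} (hw : 0 ≤ w) : gammaTail m w ≤ 1 := by
  have := isProbabilityMeasure_gammaMeasure_nat hm
  rw [← gammaMeasure_real_Ioi hm hw]
  exact measureReal_le_one

theorem gammaMeasure_real_Ioi_eq_upperGamma {m : ℕ} (hm : 0 < m) {w : ℝ} (hw : 0 ≤ w) :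
    (gammaMeasure m m).real (Set.Ioi w) = upperGamma m (m * w) / Real.Gamma m := by
  have hm' : (0 : ℝ) < m := by exact_mod_cast hm
  rw [gammaMeasure_real_Ioi hm hw]
  have h := integral_pow_mul_exp_neg_mul_Ioi (m - 1) one_pos (mul_nonneg hm'.le hw)
  have h2 : upperGamma m (m * w) = ∫ t in Set.Ioi (m * w), t ^ (m - 1) * Real.exp (-(1 * t)) := by
    refine setIntegral_congr_fun measurableSet_Ioi fun t _ => ?_
    simp only [one_mul]
    rw [← Nat.cast_one, ← Nat.cast_sub hm, Real.rpow_natCast]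
  rw [h2, h, gammaTail]
  obtain ⟨k, rfl⟩ := Nat.exists_eq_succ_of_ne_zero hm.ne'
  simp only [Nat.succ_eq_add_one, Nat.add_sub_cancel, Nat.cast_add, Nat.cast_one,
    Real.Gamma_nat_eq_factorial]
  have : (k.factorial : ℝ) ≠ 0 := by positivity
  field_simp
  simp

theorem lowerGamma_add_upperGamma {a w : ℝ} (ha : 0 < a) (hw : 0 ≤ w) :
    lowerGamma a w + upperGamma a w = Real.Gamma a := by
  have h := Real.GammaIntegral_convergent ha
  simp_rw [mul_comm (Real.exp _)] at h
  rw [lowerGamma, upperGamma, intervalIntegral.integral_of_le hw,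
    ← setIntegral_union (Set.Ioc_disjoint_Ioi le_rfl) measurableSet_Ioi
      (h.mono_set Set.Ioc_subset_Ioi_self) (h.mono_set (Set.Ioi_subset_Ioi hw)),
    Set.Ioc_union_Ioi_eq_Ioi hw, Real.Gamma_eq_integral ha]
  simp_rw [mul_comm (Real.exp _)]

theorem gammaMeasure_real_Iic_eq_lowerGamma {m : ℕ} (hm : 0 < m) {w : ℝ} (hw : 0 ≤ w) :
    (gammaMeasure m m).real (Set.Iic w) = lowerGamma m (m * w) / Real.Gamma m := by
  have hm' : (0 : ℝ) < m := by exact_mod_cast hm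
  have := isProbabilityMeasure_gammaMeasure_nat hm
  have hG := Real.Gamma_pos_of_pos hm'
  have h1 := probReal_compl_eq_one_sub (μ := gammaMeasure m m) (measurableSet_Ioi (a := w))
  rw [Set.compl_Ioi, gammaMeasure_real_Ioi_eq_upperGamma hm hw] at h1
  rw [h1, ← lowerGamma_add_upperGamma hm' (mul_nonneg hm'.le hw)] at *
  field_simp
  ring

/-! ### Averages of the gamma tail -/

theorem integrableOn_pow_mul_exp_mul_inv_pow (n b : ℕ) {R B D : ℝ} (hR : 0 < R) (hB : 0 < B)
    (hD : 0 ≤ D) :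
    IntegrableOn (fun s : ℝ => s ^ n * Real.exp (-(R * s)) * ((B + D * s) ^ b)⁻¹) (Set.Ioi 0) := by
  refine ((integrableOn_pow_mul_exp_neg_mul_Ioi n hR le_rfl).mul_const ((B ^ b)⁻¹)).mono' ?_ ?_
  · exact Measurable.aestronglyMeasurable (by fun_prop)
  · filter_upwards [ae_restrict_mem measurableSet_Ioi] with s (hs : 0 < s)
    rw [Real.norm_of_nonneg (by positivity)]
    gcongr
    nlinarith [mul_nonneg hD hs.le]

/-- The Meijer function as a Laplace-type integral with general scale parameters. -/
theorem factorial_mul_integral_eq_meijerG2112 {a b : ℕ} (ha : 0 < a) (hb : 0 < b) {R B D : ℝ}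
    (hR : 0 < R) (hB : 0 < B) (hD : 0 < D) :
    ((((b - 1).factorial : ℝ) * ∫ s in Set.Ioi (0 : ℝ),
      s ^ (a - 1) * Real.exp (-(R * s)) * ((B + D * s) ^ b)⁻¹ : ℝ) : ℂ) =
    ((B / D) ^ a * (B ^ b)⁻¹ : ℝ) * meijerG2112 (1 - (a : ℂ)) 0 ((b : ℂ) - a) ((R * B / D : ℝ) : ℂ) := by
  rw [meijerG2112_eq_integral ha hb (by positivity), ← Complex.ofReal_mul]
  congr 1
  have hΓ : Real.Gamma b = ((b - 1).factorial : ℝ) := by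
    obtain ⟨k, rfl⟩ := Nat.exists_eq_succ_of_ne_zero hb.ne'
    simp [Real.Gamma_nat_eq_factorial]
  -- The substitution `s = (B/D) w` turns `B + D s` into `B (1 + w)` and `R s` into `(R B / D) w`.
  have h := integral_comp_mul_left_Ioi
    (fun s : ℝ => s ^ (a - 1) * Real.exp (-(R * s)) * ((B + D * s) ^ b)⁻¹) 0
    (show 0 < B / D by positivity)
  rw [mul_zero, smul_eq_mul] at h
  have h' : ∫ s in Set.Ioi (0 : ℝ), s ^ (a - 1) * Real.exp (-(R * s)) * ((B + D * s) ^ b)⁻¹ =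
      (B / D) * ∫ w in Set.Ioi (0 : ℝ), (B / D * w) ^ (a - 1) * Real.exp (-(R * (B / D * w))) *
        ((B + D * (B / D * w)) ^ b)⁻¹ := by
    rw [h, mul_inv_cancel_left₀ (by positivity)]
  rw [h', hΓ, mul_left_comm _ ((b - 1).factorial : ℝ)]
  congr 1
  rw [← integral_const_mul, ← integral_const_mul]
  refine setIntegral_congr_fun measurableSet_Ioi fun w (hw : 0 < w) => ?_
  obtain ⟨k, rfl⟩ := Nat.exists_eq_succ_of_ne_zero ha.ne'
  simp only [Nat.succ_eq_add_one, Nat.add_sub_cancel]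
  rw [show B + D * (B / D * w) = B * (1 + w) by field_simp, mul_pow B, mul_inv,
    show R * (B / D * w) = R * B / D * w by ring, mul_pow (B / D), pow_succ (B / D) k]
  ring

/-- The exponentials of density and tail merge into the rate `z + x I`, and the binomial expansion
of `(S + I s)^q` leaves complete gamma integrals. -/
theorem integral_nakagamiDensity_mul_gammaTail (x : ℕ) {z : ℕ} (hz : 0 < z) {S I : ℝ}
    (hI : 0 ≤ I) :
    ∫ s in Set.Ioi (0 : ℝ), nakagamiDensity z s * gammaTail x (S + I * s) =
      ((z : ℝ) ^ z * Real.exp (-(x * S)) / Real.Gamma z) *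
      ∑ q ∈ Finset.range x, (x : ℝ) ^ q / (q.factorial : ℝ)
        * ∑ l ∈ Finset.range (q + 1), (q.choose l : ℝ)
          * (S ^ (q - l) * I ^ l * Real.Gamma ((z : ℝ) + l) / ((z : ℝ) + x * I) ^ (z + l)) := by
  have hz' : (0 : ℝ) < z := by exact_mod_cast hz
  have hR : 0 < (z : ℝ) + x * I := by positivity
  have hexpand : ∀ s : ℝ, nakagamiDensity z s * gammaTail x (S + I * s) =
      ∑ q ∈ Finset.range x, ∑ l ∈ Finset.range (q + 1),
        ((z : ℝ) ^ z * Real.exp (-(x * S)) / Real.Gamma z * ((x : ℝ) ^ q / (q.factorial : ℝ)) *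
          ((q.choose l : ℝ) * (S ^ (q - l) * I ^ l))) *
        (s ^ (z - 1 + l) * Real.exp (-(((z : ℝ) + x * I) * s))) := by
    intro s
    have he : Real.exp (-(x * (S + I * s))) * Real.exp (-(z * s)) =
        Real.exp (-(x * S)) * Real.exp (-(((z : ℝ) + x * I) * s)) := by
      rw [← Real.exp_add, ← Real.exp_add]; congr 1; ring
    have hsum : ∑ q ∈ Finset.range x, ((x : ℝ) * (S + I * s)) ^ q / (q.factorial : ℝ) =
        ∑ q ∈ Finset.range x, ∑ l ∈ Finset.range (q + 1), (x : ℝ) ^ q / (q.factorial : ℝ) *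
          ((q.choose l : ℝ) * (S ^ (q - l) * I ^ l)) * s ^ l := by
      refine Finset.sum_congr rfl fun q _ => ?_
      rw [mul_pow, add_comm S, add_pow, mul_div_right_comm, Finset.mul_sum]
      refine Finset.sum_congr rfl fun l _ => ?_
      rw [mul_pow]; ring
    rw [nakagamiDensity, gammaTail, hsum, show ∀ a b c d e : ℝ, a * b * c * (d * e) =
      a * b * (d * c) * e from fun _ _ _ _ _ => by ring, he, Finset.mul_sum]
    refine Finset.sum_congr rfl fun q _ => ?_
    rw [Finset.mul_sum]
    refine Finset.sum_congr rfl fun l _ => ?_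
    rw [pow_add]; ring
  simp_rw [hexpand]
  have hint : ∀ l : ℕ, IntegrableOn (fun s : ℝ => s ^ (z - 1 + l) *
      Real.exp (-(((z : ℝ) + x * I) * s))) (Set.Ioi 0) :=
    fun l => integrableOn_pow_mul_exp_neg_mul_Ioi _ hR le_rfl
  rw [integral_finsetSum _ fun q _ => integrable_finsetSum _ fun l _ => (hint l).const_mul _,
    Finset.mul_sum]
  refine Finset.sum_congr rfl fun q _ => ?_
  rw [integral_finsetSum _ fun l _ => (hint l).const_mul _, Finset.mul_sum, Finset.mul_sum]
  refine Finset.sum_congr rfl fun l _ => ?_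
  rw [integral_const_mul, integral_pow_mul_exp_neg_mul_Ioi _ hR le_rfl]
  obtain ⟨k, rfl⟩ := Nat.exists_eq_succ_of_ne_zero hz.ne'
  have hΓ : Real.Gamma (((k.succ : ℕ) : ℝ) + l) = ((k + l).factorial : ℝ) := by
    rw [← Real.Gamma_nat_eq_factorial]; push_cast; congr 1; ring
  -- At the lower endpoint `0` only the zeroth term of the incomplete gamma sum survives.
  rw [hΓ, Finset.sum_range_succ']
  simp only [Nat.succ_eq_add_one, Nat.add_sub_cancel, mul_zero, neg_zero, Real.exp_zero]
  rw [show k + 1 + l = k + l + 1 by ring]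
  simp
  ring

/-- Scalar factor of the expansion of the constrained part of the tail average. -/
def activeCoeff (x y : ℕ) (E V U Λ : ℝ) (k j u p t : ℕ) : ℝ :=
  (y : ℝ) ^ y / Real.Gamma y * Real.exp (-(x * E)) * Real.exp (-(Λ * (y + x * V))) *
    ((x : ℝ) ^ k / (k.factorial : ℝ) * ((k.choose j : ℝ) * E ^ (k - j)) *
      ((j.choose u : ℝ) * V ^ (j - u) * U ^ u) * ((y + j - 1).factorial : ℝ) *
      (Λ ^ p / (p.factorial : ℝ) * ((p.choose t : ℝ) * (x * U) ^ t * (y + x * V) ^ (p - t))))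

/-- For fixed `s`, the exponents in `r` merge into the rate `c = y + xV + xUs`. The index `j`
expands the level, `u` expands `(V + U s)^j`, `p` runs through the incomplete gamma sum of order `y
+ j`, and `t` expands `(cΛ)^p`. -/
theorem setIntegral_nakagamiDensity_mul_gammaTail (x : ℕ) {y : ℕ} (hy : 0 < y) {E V U Λ s : ℝ}
    (hV : 0 ≤ V) (hU : 0 ≤ U) (hΛ : 0 ≤ Λ) (hs : 0 ≤ s) :
    ∫ r in Set.Ioi Λ, nakagamiDensity y r * gammaTail x (E + r * (V + U * s)) =
      ∑ k ∈ Finset.range x, ∑ j ∈ Finset.range (k + 1), ∑ u ∈ Finset.range (j + 1),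
          ∑ p ∈ Finset.range (y + j), ∑ t ∈ Finset.range (p + 1),
            activeCoeff x y E V U Λ k j u p t *
              (s ^ (u + t) * Real.exp (-(x * U * Λ * s)) *
                (((y + x * V) + x * U * s) ^ (y + j))⁻¹) := by
  have hy' : (0 : ℝ) < y := by exact_mod_cast hy
  set c : ℝ := (y + x * V) + x * U * s with hc
  have hc0 : 0 < c := by positivity
  have hexpand : ∀ r : ℝ, nakagamiDensity y r * gammaTail x (E + r * (V + U * s)) =
      ∑ k ∈ Finset.range x, ∑ j ∈ Finset.range (k + 1),
        ((y : ℝ) ^ y / Real.Gamma y * Real.exp (-(x * E)) * ((x : ℝ) ^ k / (k.factorial : ℝ)) *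
          ((k.choose j : ℝ) * E ^ (k - j)) * (V + U * s) ^ j) *
        (r ^ (y - 1 + j) * Real.exp (-(c * r))) := by
    intro r
    have he : Real.exp (-(x * (E + r * (V + U * s)))) * Real.exp (-(y * r)) =
        Real.exp (-(x * E)) * Real.exp (-(c * r)) := by
      rw [← Real.exp_add, ← Real.exp_add]; congr 1; rw [hc]; ring
    have hsum : ∑ q ∈ Finset.range x, ((x : ℝ) * (E + r * (V + U * s))) ^ q / (q.factorial : ℝ) =
        ∑ k ∈ Finset.range x, ∑ j ∈ Finset.range (k + 1), (x : ℝ) ^ k / (k.factorial : ℝ) *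
          ((k.choose j : ℝ) * E ^ (k - j)) * (V + U * s) ^ j * r ^ j := by
      refine Finset.sum_congr rfl fun q _ => ?_
      rw [mul_pow, add_comm E, add_pow, mul_div_right_comm, Finset.mul_sum]
      refine Finset.sum_congr rfl fun l _ => ?_
      rw [mul_pow]; ring
    rw [nakagamiDensity, gammaTail, hsum, show ∀ a b c d e : ℝ, a * b * c * (d * e) =
      a * b * (d * c) * e from fun _ _ _ _ _ => by ring, he, Finset.mul_sum]
    refine Finset.sum_congr rfl fun q _ => ?_
    rw [Finset.mul_sum]
    refine Finset.sum_congr rfl fun l _ => ?_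
    rw [pow_add]; ring
  simp_rw [hexpand]
  have hint : ∀ j : ℕ, IntegrableOn (fun r : ℝ => r ^ (y - 1 + j) * Real.exp (-(c * r)))
      (Set.Ioi Λ) := fun j => integrableOn_pow_mul_exp_neg_mul_Ioi _ hc0 hΛ
  rw [integral_finsetSum _ fun q _ => integrable_finsetSum _ fun l _ => (hint l).const_mul _]
  refine Finset.sum_congr rfl fun k _ => ?_
  rw [integral_finsetSum _ fun l _ => (hint l).const_mul _]
  refine Finset.sum_congr rfl fun j _ => ?_
  rw [integral_const_mul, integral_pow_mul_exp_neg_mul_Ioi _ hc0 hΛ]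
  rw [add_comm V, add_pow, Finset.mul_sum, Finset.sum_mul]
  refine Finset.sum_congr rfl fun u _ => ?_
  have hyj : y - 1 + j + 1 = y + j := by omega
  have hyj' : y - 1 + j = y + j - 1 := by omega
  rw [hyj, hyj', Finset.mul_sum, Finset.mul_sum, Finset.mul_sum]
  refine Finset.sum_congr rfl fun p _ => ?_
  have hpow : (c * Λ) ^ p = ∑ t ∈ Finset.range (p + 1),
      Λ ^ p * ((p.choose t : ℝ) * (x * U) ^ t * (y + x * V) ^ (p - t)) * s ^ t := by
    rw [mul_pow, hc, add_comm, add_pow, Finset.sum_mul]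
    refine Finset.sum_congr rfl fun t _ => ?_
    rw [mul_pow (x * U)]; ring
  have he : Real.exp (-(c * Λ)) =
      Real.exp (-(Λ * (y + x * V))) * Real.exp (-(x * U * Λ * s)) := by
    rw [← Real.exp_add, hc]; congr 1; ring
  rw [hpow, he, Finset.sum_div, Finset.mul_sum, Finset.mul_sum, Finset.mul_sum]
  refine Finset.sum_congr rfl fun t _ => ?_
  rw [activeCoeff, mul_pow U s, pow_add s]
  ring

theorem integral_setIntegral_nakagamiDensity_mul_gammaTail (x : ℕ) {y z : ℕ} (hy : 0 < y)
    (hz : 0 < z) {E V U Λ : ℝ} (hV : 0 ≤ V) (hU : 0 ≤ U) (hΛ : 0 ≤ Λ) :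
    ∫ s in Set.Ioi 0, nakagamiDensity z s *
      ∫ r in Set.Ioi Λ, nakagamiDensity y r * gammaTail x (E + r * (V + U * s)) =
      ∑ k ∈ Finset.range x, ∑ j ∈ Finset.range (k + 1), ∑ u ∈ Finset.range (j + 1),
          ∑ p ∈ Finset.range (y + j), ∑ t ∈ Finset.range (p + 1),
            ((z : ℝ) ^ z / Real.Gamma z * activeCoeff x y E V U Λ k j u p t) *
              ∫ s in Set.Ioi (0 : ℝ), s ^ (z + u + t - 1) *
                Real.exp (-((z + x * Λ * U) * s)) * (((y + x * V) + x * U * s) ^ (y + j))⁻¹ := by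
  have hy' : (0 : ℝ) < y := by exact_mod_cast hy
  have hz' : (0 : ℝ) < z := by exact_mod_cast hz
  have hexpand : ∀ s ∈ Set.Ioi (0 : ℝ), nakagamiDensity z s *
      ∫ r in Set.Ioi Λ, nakagamiDensity y r * gammaTail x (E + r * (V + U * s)) =
      ∑ k ∈ Finset.range x, ∑ j ∈ Finset.range (k + 1), ∑ u ∈ Finset.range (j + 1),
          ∑ p ∈ Finset.range (y + j), ∑ t ∈ Finset.range (p + 1),
            ((z : ℝ) ^ z / Real.Gamma z * activeCoeff x y E V U Λ k j u p t) *
              (s ^ (z + u + t - 1) *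
                Real.exp (-((z + x * Λ * U) * s)) * (((y + x * V) + x * U * s) ^ (y + j))⁻¹) := by
    intro s (hs : 0 < s)
    rw [setIntegral_nakagamiDensity_mul_gammaTail x hy hV hU hΛ hs.le]
    simp_rw [Finset.mul_sum]
    refine Finset.sum_congr rfl fun k _ => Finset.sum_congr rfl fun j _ =>
      Finset.sum_congr rfl fun u _ => Finset.sum_congr rfl fun p _ =>
      Finset.sum_congr rfl fun t _ => ?_
    have he : Real.exp (-((z + x * Λ * U) * s)) =
        Real.exp (-(z * s)) * Real.exp (-(x * U * Λ * s)) := by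
      rw [← Real.exp_add]; congr 1; ring
    rw [he, nakagamiDensity, show z + u + t - 1 = (z - 1) + (u + t) by omega, pow_add s (z - 1)]
    ring
  rw [setIntegral_congr_fun measurableSet_Ioi hexpand]
  have hint : ∀ u j t : ℕ, IntegrableOn (fun s : ℝ => s ^ (z + u + t - 1) *
      Real.exp (-((z + x * Λ * U) * s)) * (((y + x * V) + x * U * s) ^ (y + j))⁻¹) (Set.Ioi 0) :=
    fun u j t => integrableOn_pow_mul_exp_mul_inv_pow _ _ (by positivity) (by positivity)
      (by positivity)
  rw [integral_finsetSum _ fun k _ => integrable_finsetSum _ fun j _ => integrable_finsetSum _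
    fun u _ => integrable_finsetSum _ fun p _ => integrable_finsetSum _
    fun t _ => (hint u j t).const_mul _]
  refine Finset.sum_congr rfl fun k _ => ?_
  rw [integral_finsetSum _ fun j _ => integrable_finsetSum _
    fun u _ => integrable_finsetSum _ fun p _ => integrable_finsetSum _
    fun t _ => (hint u j t).const_mul _]
  refine Finset.sum_congr rfl fun j _ => ?_
  rw [integral_finsetSum _
    fun u _ => integrable_finsetSum _ fun p _ => integrable_finsetSum _
    fun t _ => (hint u j t).const_mul _]
  refine Finset.sum_congr rfl fun u _ => ?_
  rw [integral_finsetSum _ fun p _ => integrable_finsetSum _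
    fun t _ => (hint u j t).const_mul _]
  refine Finset.sum_congr rfl fun p _ => ?_
  rw [integral_finsetSum _ fun t _ => (hint u j t).const_mul _]
  exact Finset.sum_congr rfl fun t _ => integral_const_mul _ _

/-- The Meijer identity applies with `a = z + u + t`, `b = y + j` and `D = xU`. Its factor `(B/D)^a
B^(-b)` absorbs `U^u (xU)^t B^(p-t)` and leaves `U^(-z)`, `x^(-z-u)` and `B^(p+u+z-j-y)`. -/
theorem activeCoeff_mul_integral_eq (x : ℕ) {y z : ℕ} (hx : 0 < x) (hy : 0 < y) (hz : 0 < z)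
    {E V U Λ : ℝ} (hV : 0 ≤ V) (hU : 0 < U) (hΛ : 0 ≤ Λ) {k j u p t : ℕ} (htp : t ≤ p) :
    ((((z : ℝ) ^ z / Real.Gamma z * activeCoeff x y E V U Λ k j u p t) *
        ∫ s in Set.Ioi (0 : ℝ), s ^ (z + u + t - 1) *
          Real.exp (-((z + x * Λ * U) * s)) * (((y + x * V) + x * U * s) ^ (y + j))⁻¹ : ℝ) : ℂ) =
    (((z : ℝ) ^ z * Real.exp (-(Λ * (y + x * V))) / Real.Gamma z
        * ((y : ℝ) ^ y * Real.exp (-(x * E)) / (U ^ z * Real.Gamma y)) : ℝ) : ℂ) *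
      ((((x : ℝ) ^ ((k : ℤ) - z - u) / (k.factorial : ℝ)
              * (k.choose j : ℝ) * E ^ (k - j)
              * (j.choose u : ℝ) * V ^ (j - u)
              * (Λ ^ p / (p.factorial : ℝ)) * (p.choose t : ℝ)
              * (y + x * V) ^ ((p : ℤ) + u + z - j - y) : ℝ) : ℂ)
            * meijerG2112 (1 - ((z : ℂ) + u + t)) 0 ((y : ℂ) + j - z - u - t)
                (((z + x * Λ * U) / (x * U * (y + x * V)⁻¹) : ℝ) : ℂ)) := by
  have hx' : (0 : ℝ) < x := by exact_mod_cast hx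
  have hy' : (0 : ℝ) < y := by exact_mod_cast hy
  have hz' : (0 : ℝ) < z := by exact_mod_cast hz
  set B : ℝ := y + x * V with hB
  have hB0 : 0 < B := by positivity
  have hG := factorial_mul_integral_eq_meijerG2112 (a := z + u + t) (b := y + j) (by omega)
    (by omega) (R := z + x * Λ * U) (B := B) (D := x * U) (by positivity) hB0 (by positivity)
  have harg : (z + x * Λ * U) * B / (x * U) = (z + x * Λ * U) / (x * U * B⁻¹) := by field_simp
  have hpar : (((y + j : ℕ) : ℂ)) - ((z + u + t : ℕ) : ℂ) = (y : ℂ) + j - z - u - t := by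
    push_cast; ring
  rw [harg, hpar] at hG
  rw [show ((z + u + t : ℕ) : ℂ) = (z : ℂ) + u + t by push_cast; ring, Complex.ofReal_mul] at hG
  rw [← mul_assoc, ← Complex.ofReal_mul]
  set G := meijerG2112 (1 - ((z : ℂ) + u + t)) 0 ((y : ℂ) + j - z - u - t)
                (((z + x * Λ * U) / (x * U * B⁻¹) : ℝ) : ℂ)
  set J := ∫ s in Set.Ioi (0 : ℝ), s ^ (z + u + t - 1) *
          Real.exp (-((z + x * Λ * U) * s)) * ((B + x * U * s) ^ (y + j))⁻¹
  have hf : (((y + j - 1).factorial : ℝ) : ℂ) ≠ 0 := by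
    exact_mod_cast (y + j - 1).factorial_ne_zero
  -- The Meijer identity carries the factor `(y+j-1)!`, so both sides are multiplied by it; on the
  -- other side it matches the factorial inside `activeCoeff`.
  refine mul_left_cancel₀ hf ?_
  rw [Complex.ofReal_mul _ J, mul_left_comm, hG, ← mul_assoc, ← mul_assoc, ← Complex.ofReal_mul,
    ← Complex.ofReal_mul]
  congr 2
  obtain ⟨d, rfl⟩ := Nat.exists_eq_add_of_le htp
  have hΓy := (Real.Gamma_pos_of_pos hy').ne'
  have hΓz := (Real.Gamma_pos_of_pos hz').ne'
  have hxz : (x : ℝ) ^ ((k : ℤ) - z - u) = x ^ k / x ^ z / x ^ u := by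
    rw [zpow_sub₀ hx'.ne', zpow_sub₀ hx'.ne']; simp only [zpow_natCast]
  have hBz : B ^ (((t + d : ℕ) : ℤ) + u + z - j - y) = B ^ (t + d) * B ^ u * B ^ z / B ^ j / B ^ y := by
    rw [zpow_sub₀ hB0.ne', zpow_sub₀ hB0.ne', zpow_add₀ hB0.ne', zpow_add₀ hB0.ne']
    simp only [zpow_natCast]
  rw [hxz, hBz, activeCoeff, ← hB, Nat.add_sub_cancel_left, div_pow, mul_pow, mul_pow]
  simp only [pow_add]
  have := (y + j - 1).factorial_ne_zero
  field_simp

/-! ### The decoding event -/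

namespace Network

variable {C : ℕ} (N : Network C) (i : Phase)

theorem fraction_pos : 0 < N.fraction i := by
  cases i
  · exact N.lam_pos
  · exact sub_pos.2 N.lam_lt_one

theorem thr_pos : 0 < N.thr i :=
  sub_pos.2 (Real.one_lt_rpow one_lt_two
    (div_pos N.Rbar_pos (mul_pos (N.fraction_pos i) N.W_pos)))

theorem Pbar_pos : 0 < N.Pbar i := div_pos (N.Ptot_pos i) (by exact_mod_cast N.K_pos)

theorem rhop_pos : 0 < N.rhop i :=
  div_pos (mul_pos N.Pp_pos (N.ellp_pos i)) (by exact_mod_cast N.K_pos)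

theorem Isic_nonneg : 0 ≤ N.Isic i := Finset.sum_nonneg fun m _ => N.v_nonneg i m

theorem E_nonneg : 0 ≤ N.E i :=
  mul_nonneg (N.err_nonneg i) (add_nonneg zero_le_one (N.hi_nonneg i))

theorem one_add_hip_pos : 0 < 1 + N.hip i := add_pos_of_pos_of_nonneg one_pos (N.hip_nonneg i)

theorem ITCn_pos : 0 < N.ITCn i := div_pos N.ITC_pos (N.ellk_pos i)

theorem Lam_pos : 0 < N.Lam i := div_pos (N.ITCn_pos i) (N.Pbar_pos i)

variable {N i}

theorem calE_nonneg (hA : 0 < N.A i) : 0 ≤ N.calE i :=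
  div_nonneg (mul_nonneg (N.E_nonneg i) (N.thr_pos i).le) hA.le

theorem calS_pos (hA : 0 < N.A i) : 0 < N.calS i := by
  have := N.noise_pos i; have := N.Pbar_pos i; have := N.ell_pos i; have := N.thr_pos i
  unfold calS; positivity

theorem calI_pos (hA : 0 < N.A i) : 0 < N.calI i := by
  have := N.rhop_pos i; have := N.Pbar_pos i; have := N.ell_pos i; have := N.thr_pos i
  have := N.one_add_hip_pos i
  unfold calI; positivity

theorem calV_pos (hA : 0 < N.A i) : 0 < N.calV i := by
  have := N.noise_pos i; have := N.ITCn_pos i; have := N.ell_pos i; have := N.thr_pos i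
  unfold calV; positivity

theorem calU_pos (hA : 0 < N.A i) : 0 < N.calU i := by
  have := N.rhop_pos i; have := N.ITCn_pos i; have := N.ell_pos i; have := N.thr_pos i
  have := N.one_add_hip_pos i
  unfold calU; positivity

theorem txPower_pos (y : ℝ) : 0 < N.txPower i y := by
  have hP := N.Pbar_pos i
  unfold txPower
  split_ifs with h
  · exact hP
  · have h1 := N.ITC_pos.trans (not_le.1 h)
    exact div_pos N.ITC_pos (pos_of_mul_pos_right h1 hP.le)

theorem txPower_of_le {y : ℝ} (hy : y ≤ N.Lam i) : N.txPower i y = N.Pbar i := by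
  refine if_pos ?_
  rwa [Lam, ITCn, div_div, le_div_iff₀ (mul_pos (N.ellk_pos i) (N.Pbar_pos i)), mul_comm,
    mul_comm (N.ellk i), mul_assoc] at hy

theorem txPower_of_lt {y : ℝ} (hy : N.Lam i < y) : N.txPower i y = N.ITC / (N.ellk i * y) := by
  refine if_neg (not_le.2 ?_)
  rwa [Lam, ITCn, div_div, div_lt_iff₀ (mul_pos (N.ellk_pos i) (N.Pbar_pos i)), mul_comm y,
    mul_comm (N.ellk i), mul_assoc] at hy

variable (N i)

theorem measurable_txPower : Measurable (N.txPower i) :=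
  Measurable.ite (measurableSet_le (by fun_prop) measurable_const) measurable_const (by fun_prop)

theorem measurable_sidnrAt_txPower :
    Measurable fun p : (ℝ × ℝ) × ℝ => N.sidnrAt i (N.txPower i p.1.1) p.2 p.1.2 := by
  have := N.measurable_txPower i
  unfold sidnrAt
  fun_prop

/-- Least power gain of the estimated channel at which decoding succeeds, given the power gains
`y` to the primary user and `z` from the primary base station. -/
def level (y z : ℝ) : ℝ :=
  (N.E i + z * (N.rhop i / (N.txPower i y * N.ell i) * (1 + N.hip i))
    + N.noise i / (N.txPower i y * N.ell i)) * N.thr i / N.A i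

theorem measurable_level : Measurable fun p : ℝ × ℝ => N.level i p.1 p.2 := by
  have := N.measurable_txPower i
  unfold level
  fun_prop

variable {N i}

theorem level_nonneg (hA : 0 < N.A i) (y : ℝ) {z : ℝ} (hz : 0 ≤ z) : 0 ≤ N.level i y z := by
  have := N.rhop_pos i; have := N.txPower_pos (i := i) y; have := N.ell_pos i
  have := N.thr_pos i; have := N.one_add_hip_pos i; have := N.noise_pos i; have := N.E_nonneg i
  unfold level; positivity

theorem level_of_le {y : ℝ} (hy : y ≤ N.Lam i) (z : ℝ) :
    N.level i y z = (N.calE i + N.calS i) + N.calI i * z := by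
  rw [level, txPower_of_le hy, calE, calS, calI]
  ring

/-- Here the power is `ITC / (ellk * y)`, so the noise and interference terms, which contain its
inverse, become linear in `y`. -/
theorem level_of_lt {y : ℝ} (hy : N.Lam i < y) (z : ℝ) :
    N.level i y z = N.calE i + y * (N.calV i + N.calU i * z) := by
  have hk := (N.ellk_pos i).ne'
  have hI := N.ITC_pos.ne'
  have hl := (N.ell_pos i).ne'
  have hy0 : y ≠ 0 := ((N.Lam_pos i).trans hy).ne'
  rw [level, txPower_of_lt hy, calE, calV, calU, ITCn]
  field_simp
  ring

theorem sidnrAt_denominator_pos {P x z : ℝ} (hP : 0 < P) (hx : 0 ≤ x) (hz : 0 ≤ z) :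
    0 < x * N.Isic i + x * N.hi i + N.E i
      + z * (N.rhop i / (P * N.ell i) * (1 + N.hip i)) + N.noise i / (P * N.ell i) := by
  have := N.rhop_pos i; have := N.ell_pos i; have := N.Isic_nonneg i; have := N.hi_nonneg i
  have := N.one_add_hip_pos i; have := N.noise_pos i; have := N.E_nonneg i
  positivity

/-- After the positive denominator is cleared, the terms in `x` collect to `x * N.A i`, and division
by it keeps the direction of the inequality. -/
theorem thr_le_sidnrAt_iff (hA : 0 < N.A i) {x y z : ℝ} (hx : 0 ≤ x) (hz : 0 ≤ z) :
    N.thr i ≤ N.sidnrAt i (N.txPower i y) x z ↔ N.level i y z ≤ x := by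
  rw [sidnrAt, le_div_iff₀ (sidnrAt_denominator_pos (N.txPower_pos y) hx hz), level,
    div_le_iff₀ hA, A]
  constructor <;> intro h <;> linarith

theorem thr_lt_sidnrAt_iff (hA : 0 < N.A i) {x y z : ℝ} (hx : 0 ≤ x) (hz : 0 ≤ z) :
    N.thr i < N.sidnrAt i (N.txPower i y) x z ↔ N.level i y z < x := by
  rw [sidnrAt, lt_div_iff₀ (sidnrAt_denominator_pos (N.txPower_pos y) hx hz), level,
    div_lt_iff₀ hA, A]
  constructor <;> intro h <;> linarith

/-! ### The success probability -/

variable (N i) in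
/-- Joint law of the power gains to the primary user and from the primary base station. -/
def interferenceLaw : Measure (ℝ × ℝ) :=
  (gammaMeasure (N.mY i) (N.mY i)).prod (gammaMeasure (N.mZ i) (N.mZ i))

/-- The joint law of the power gains gives the success event, in its strict and its weak form, the
average of the gamma tail. -/
theorem prod_law_success_event (hA : 0 < N.A i) :
    ((N.interferenceLaw i).prod (gammaMeasure (N.mX i) (N.mX i)))
      {p | N.thr i < N.sidnrAt i (N.txPower i p.1.1) p.2 p.1.2} =
    ∫⁻ q, ENNReal.ofReal (gammaTail (N.mX i) (N.level i q.1 q.2)) ∂N.interferenceLaw i ∧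
    ((N.interferenceLaw i).prod (gammaMeasure (N.mX i) (N.mX i)))
      {p | N.thr i ≤ N.sidnrAt i (N.txPower i p.1.1) p.2 p.1.2} =
    ∫⁻ q, ENNReal.ofReal (gammaTail (N.mX i) (N.level i q.1 q.2)) ∂N.interferenceLaw i := by
  have := isProbabilityMeasure_gammaMeasure_nat (N.mX_pos i)
  have := isProbabilityMeasure_gammaMeasure_nat (N.mY_pos i)
  have := isProbabilityMeasure_gammaMeasure_nat (N.mZ_pos i)
  have hz : ∀ᵐ q ∂N.interferenceLaw i, 0 < q.2 :=
    Measure.quasiMeasurePreserving_snd.ae gammaMeasure_Ioi_zero_ae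
  have htail : ∀ w : ℝ, 0 ≤ w → gammaMeasure (N.mX i) (N.mX i) (Set.Ioi w) =
      ENNReal.ofReal (gammaTail (N.mX i) w) := fun w hw => by
    rw [← gammaMeasure_real_Ioi (N.mX_pos i) hw, ofReal_measureReal]
  have hm := N.measurable_sidnrAt_txPower i
  constructor
  · rw [Measure.prod_apply (measurableSet_lt measurable_const hm)]
    refine lintegral_congr_ae ?_
    filter_upwards [hz] with q hq
    rw [← htail _ (level_nonneg hA _ hq.le)]
    refine measure_congr ?_
    filter_upwards [gammaMeasure_Ioi_zero_ae] with x hx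
    exact propext (thr_lt_sidnrAt_iff hA hx.le hq.le)
  · rw [Measure.prod_apply (measurableSet_le measurable_const hm)]
    refine lintegral_congr_ae ?_
    filter_upwards [hz] with q hq
    rw [← htail _ (level_nonneg hA _ hq.le), ← gammaMeasure_Ici_eq_Ioi]
    refine measure_congr ?_
    filter_upwards [gammaMeasure_Ioi_zero_ae] with x hx
    exact propext (thr_le_sidnrAt_iff hA hx.le hq.le)

theorem interferenceLaw_isProbabilityMeasure : IsProbabilityMeasure (N.interferenceLaw i) := by
  have := isProbabilityMeasure_gammaMeasure_nat (N.mY_pos i)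
  have := isProbabilityMeasure_gammaMeasure_nat (N.mZ_pos i)
  unfold interferenceLaw
  infer_instance

theorem integrable_gammaTail_level (hA : 0 < N.A i) :
    Integrable (fun q => gammaTail (N.mX i) (N.level i q.1 q.2)) (N.interferenceLaw i) := by
  have := interferenceLaw_isProbabilityMeasure (N := N) (i := i)
  have := isProbabilityMeasure_gammaMeasure_nat (N.mY_pos i)
  have := isProbabilityMeasure_gammaMeasure_nat (N.mZ_pos i)
  refine (integrable_const (1 : ℝ)).mono'
    ((continuous_gammaTail _).measurable.comp (N.measurable_level i)).aestronglyMeasurable ?_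
  have hz : ∀ᵐ q ∂N.interferenceLaw i, 0 < q.2 :=
    Measure.quasiMeasurePreserving_snd.ae gammaMeasure_Ioi_zero_ae
  filter_upwards [hz] with q hq
  have hl := level_nonneg hA q.1 hq.le
  rw [Real.norm_of_nonneg (gammaTail_nonneg _ hl)]
  exact gammaTail_le_one (N.mX_pos i) hl

theorem gammaTail_level_nonneg_ae (hA : 0 < N.A i) :
    0 ≤ᵐ[N.interferenceLaw i] fun q => gammaTail (N.mX i) (N.level i q.1 q.2) := by
  have := isProbabilityMeasure_gammaMeasure_nat (N.mZ_pos i)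
  have hz : ∀ᵐ q ∂N.interferenceLaw i, 0 < q.2 :=
    Measure.quasiMeasurePreserving_snd.ae gammaMeasure_Ioi_zero_ae
  filter_upwards [hz] with q hq
  exact gammaTail_nonneg _ (level_nonneg hA _ hq.le)

/-- Average of the gamma tail over the interference, split according to whether the interference
temperature constraint is active. -/
theorem integral_gammaTail_level (hA : 0 < N.A i) :
    ∫ q, gammaTail (N.mX i) (N.level i q.1 q.2) ∂N.interferenceLaw i =
      (gammaMeasure (N.mY i) (N.mY i)).real (Set.Iic (N.Lam i)) *
        (∫ s in Set.Ioi (0 : ℝ), nakagamiDensity (N.mZ i) s *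
          gammaTail (N.mX i) ((N.calE i + N.calS i) + N.calI i * s)) +
      ∫ s in Set.Ioi 0, nakagamiDensity (N.mZ i) s *
        ∫ r in Set.Ioi (N.Lam i), nakagamiDensity (N.mY i) r *
          gammaTail (N.mX i) (N.calE i + r * (N.calV i + N.calU i * s)) := by
  have := isProbabilityMeasure_gammaMeasure_nat (N.mY_pos i)
  have := isProbabilityMeasure_gammaMeasure_nat (N.mZ_pos i)
  have hint := integrable_gammaTail_level hA
  rw [interferenceLaw] at hint ⊢
  -- The gain to the primary user becomes the inner variable, since the split at `Λ` concerns it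
  -- alone.
  rw [integral_prod_symm _ hint]
  have hsplit : ∀ s : ℝ, Integrable (fun r => gammaTail (N.mX i) (N.level i r s))
      (gammaMeasure (N.mY i) (N.mY i)) →
      ∫ r, gammaTail (N.mX i) (N.level i r s) ∂gammaMeasure (N.mY i) (N.mY i) =
      (gammaMeasure (N.mY i) (N.mY i)).real (Set.Iic (N.Lam i)) *
        gammaTail (N.mX i) ((N.calE i + N.calS i) + N.calI i * s) +
      ∫ r in Set.Ioi (N.Lam i), nakagamiDensity (N.mY i) r *
          gammaTail (N.mX i) (N.calE i + r * (N.calV i + N.calU i * s)) := by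
    intro s hs
    rw [← integral_add_compl (measurableSet_Iic (a := N.Lam i)) hs, Set.compl_Iic]
    congr 1
    · rw [setIntegral_congr_fun measurableSet_Iic fun r (hr : r ≤ N.Lam i) => by
        rw [level_of_le hr s], setIntegral_const, smul_eq_mul]
    · rw [setIntegral_congr_fun measurableSet_Ioi fun r (hr : N.Lam i < r) => by
        rw [level_of_lt hr s], setIntegral_gammaMeasure (N.mY_pos i) _ (N.Lam_pos i).le]
  have hae : ∀ᵐ s ∂gammaMeasure (N.mZ i) (N.mZ i), Integrable
      (fun r => gammaTail (N.mX i) (N.level i r s)) (gammaMeasure (N.mY i) (N.mY i)) :=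
    hint.prod_left_ae
  have hin : Integrable (fun s => (gammaMeasure (N.mY i) (N.mY i)).real (Set.Iic (N.Lam i)) *
        gammaTail (N.mX i) ((N.calE i + N.calS i) + N.calI i * s))
      (gammaMeasure (N.mZ i) (N.mZ i)) := by
    refine Integrable.const_mul ((integrable_const (1 : ℝ)).mono'
      ((continuous_gammaTail _).comp (by fun_prop)).aestronglyMeasurable ?_) _
    filter_upwards [gammaMeasure_Ioi_zero_ae] with s hs
    have hl : 0 ≤ (N.calE i + N.calS i) + N.calI i * s := by
      have := calE_nonneg hA; have := calS_pos hA; have := calI_pos hA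
      positivity
    rw [Function.comp_apply, Real.norm_of_nonneg (gammaTail_nonneg _ hl)]
    exact gammaTail_le_one (N.mX_pos i) hl
  have hact : Integrable (fun s => ∫ r in Set.Ioi (N.Lam i), nakagamiDensity (N.mY i) r *
          gammaTail (N.mX i) (N.calE i + r * (N.calV i + N.calU i * s)))
      (gammaMeasure (N.mZ i) (N.mZ i)) := by
    -- Integrability of the constrained part comes for free, as the full inner integral minus the
    -- unconstrained part.
    refine (hint.integral_prod_right.sub hin).congr ?_
    filter_upwards [hae] with s hs
    rw [Pi.sub_apply, hsplit s hs]
    ring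
  rw [integral_congr_ae (hae.mono hsplit), integral_add hin hact, integral_const_mul,
    integral_gammaMeasure (N.mZ_pos i), integral_gammaMeasure (N.mZ_pos i)]

theorem one_sub_integral_gammaTail_level (hA : 0 < N.A i) :
    ((1 - ∫ q, gammaTail (N.mX i) (N.level i q.1 q.2) ∂N.interferenceLaw i : ℝ) : ℂ) =
      N.closedCDF i := by
  have hy : (0 : ℝ) < N.mY i := by exact_mod_cast N.mY_pos i
  have hΛ := N.Lam_pos i
  -- Writing `1` as the probabilities of the two constraint regimes supplies the leading term of
  -- each half of the closed form.
  have hone : lowerGamma (N.mY i) (N.mY i * N.Lam i) / Real.Gamma (N.mY i) +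
      upperGamma (N.mY i) (N.mY i * N.Lam i) / Real.Gamma (N.mY i) = 1 := by
    rw [← add_div, lowerGamma_add_upperGamma hy (by positivity),
      div_self (Real.Gamma_pos_of_pos hy).ne']
  have hactive : ((∫ s in Set.Ioi 0, nakagamiDensity (N.mZ i) s *
        ∫ r in Set.Ioi (N.Lam i), nakagamiDensity (N.mY i) r *
          gammaTail (N.mX i) (N.calE i + r * (N.calV i + N.calU i * s)) : ℝ) : ℂ) =
      ((upperGamma (N.mY i) (N.mY i * N.Lam i) / Real.Gamma (N.mY i) : ℝ) : ℂ)
        - N.closedActive i := by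
    rw [integral_setIntegral_nakagamiDensity_mul_gammaTail _ (N.mY_pos i) (N.mZ_pos i)
      (calV_pos hA).le (calU_pos hA).le hΛ.le, closedActive, sub_sub_cancel]
    simp_rw [Complex.ofReal_sum, Finset.mul_sum]
    refine Finset.sum_congr rfl fun k _ => Finset.sum_congr rfl fun j _ =>
      Finset.sum_congr rfl fun u _ => Finset.sum_congr rfl fun p _ =>
      Finset.sum_congr rfl fun t ht => ?_
    exact activeCoeff_mul_integral_eq _ (N.mX_pos i) (N.mY_pos i) (N.mZ_pos i) (calV_pos hA).le
      (calU_pos hA) hΛ.le (Nat.lt_succ_iff.1 (Finset.mem_range.1 ht))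
  rw [integral_gammaTail_level hA, gammaMeasure_real_Iic_eq_lowerGamma (N.mY_pos i) hΛ.le,
    integral_nakagamiDensity_mul_gammaTail _ (N.mZ_pos i) (calI_pos hA).le, ← hone, closedCDF,
    closedInactive, Complex.ofReal_sub, Complex.ofReal_add (_ * _), hactive]
  push_cast
  ring

end Network

end CRNoma

end

/-! ### The distribution function of the SIDNR at the threshold -/

theorem lemma1 {Ω : Type*} [MeasurableSpace Ω] (μ : Measure Ω) [IsProbabilityMeasure μ]
    {C : ℕ} (N : CRNoma.Network C) (hX hY hZ : CRNoma.Phase → Ω → ℂ)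
    (lawX : ∀ i, CRNoma.IsNakagami μ (hX i) (N.mX i))
    (lawY : ∀ i, CRNoma.IsNakagami μ (hY i) (N.mY i))
    (lawZ : ∀ i, CRNoma.IsNakagami μ (hZ i) (N.mZ i))
    (indep : ∀ i, iIndepFun
      ![fun ω => ‖hX i ω‖ ^ 2, fun ω => ‖hY i ω‖ ^ 2, fun ω => ‖hZ i ω‖ ^ 2] μ)
    (i : CRNoma.Phase) (hA : 0 < N.A i) :
    let γ : Ω → ℝ := fun ω => N.sidnr i (hX i ω) (hY i ω) (hZ i ω)
    AEMeasurable γ μ ∧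
    μ.real {ω | N.thr i ≤ γ ω} = 1 - μ.real {ω | γ ω < N.thr i} ∧
    μ.real {ω | N.thr i ≤ γ ω} = 1 - cdf (μ.map γ) (N.thr i) ∧
    ((cdf (μ.map γ) (N.thr i) : ℝ) : ℂ) = N.closedCDF i := by
  intro γ
  have hX' := (lawX i).aemeasurable
  have hY' := (lawY i).aemeasurable
  have hZ' := (lawZ i).aemeasurable
  have hmeas : ∀ k, AEMeasurable (![fun ω => ‖hX i ω‖ ^ 2, fun ω => ‖hY i ω‖ ^ 2,
      fun ω => ‖hZ i ω‖ ^ 2] k) μ := by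
    intro k
    fin_cases k
    · exact hX'
    · exact hY'
    · exact hZ'
  have hYZ : IndepFun (fun ω => ‖hY i ω‖ ^ 2) (fun ω => ‖hZ i ω‖ ^ 2) μ :=
    (indep i).indepFun (i := 1) (j := 2) (by decide)
  have hYZX : IndepFun (fun ω => (‖hY i ω‖ ^ 2, ‖hZ i ω‖ ^ 2)) (fun ω => ‖hX i ω‖ ^ 2) μ :=
    (indep i).indepFun_prodMk₀ hmeas 1 2 0 (by decide) (by decide)
  -- The order `((Y, Z), X)` lets the slice over fixed interference gains be an event in `X` alone.
  have hjoint : μ.map (fun ω => ((‖hY i ω‖ ^ 2, ‖hZ i ω‖ ^ 2), ‖hX i ω‖ ^ 2)) =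
      (N.interferenceLaw i).prod (gammaMeasure (N.mX i) (N.mX i)) := by
    rw [(indepFun_iff_map_prod_eq_prod_map_map (hY'.prodMk hZ') hX').1 hYZX,
      (indepFun_iff_map_prod_eq_prod_map_map hY' hZ').1 hYZ, (lawX i).map_eq, (lawY i).map_eq,
      (lawZ i).map_eq]
    rfl
  have hV := (hY'.prodMk hZ').prodMk hX'
  have hg := N.measurable_sidnrAt_txPower i
  have hγ : AEMeasurable γ μ := hg.comp_aemeasurable hV
  set c : ℝ := ∫ q, CRNoma.gammaTail (N.mX i) (N.level i q.1 q.2) ∂N.interferenceLaw i with hc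
  have hce : ∫⁻ q, ENNReal.ofReal (CRNoma.gammaTail (N.mX i) (N.level i q.1 q.2))
      ∂N.interferenceLaw i = ENNReal.ofReal c := by
    exact (ofReal_integral_eq_lintegral_ofReal (CRNoma.Network.integrable_gammaTail_level hA)
      (CRNoma.Network.gammaTail_level_nonneg_ae hA)).symm
  have hc0 : 0 ≤ c := integral_nonneg_of_ae (CRNoma.Network.gammaTail_level_nonneg_ae hA)
  obtain ⟨hlt, hle⟩ := CRNoma.Network.prod_law_success_event hA
  have hlt' : μ.real {ω | N.thr i < γ ω} = c := by
    rw [hce, ← hjoint, Measure.map_apply_of_aemeasurable hV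
      (measurableSet_lt measurable_const hg)] at hlt
    exact (congrArg ENNReal.toReal hlt).trans (ENNReal.toReal_ofReal hc0)
  have hle' : μ.real {ω | N.thr i ≤ γ ω} = c := by
    rw [hce, ← hjoint, Measure.map_apply_of_aemeasurable hV
      (measurableSet_le measurable_const hg)] at hle
    exact (congrArg ENNReal.toReal hle).trans (ENNReal.toReal_ofReal hc0)
  -- The distribution function measures `γ ≤ γ̄`, whose complement is the strict event; hence the
  -- need for `hlt'` beside `hle'`.
  have hcdf : cdf (μ.map γ) (N.thr i) = 1 - c := by
    have := Measure.isProbabilityMeasure_map hγ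
    rw [cdf_eq_real, map_measureReal_apply_of_aemeasurable hγ measurableSet_Iic, ← hlt',
      ← probReal_compl_eq_one_sub₀ (nullMeasurableSet_lt aemeasurable_const hγ)]
    congr 1
    ext ω
    simp
  refine ⟨hγ, ?_, by rw [hle', hcdf, sub_sub_cancel], ?_⟩
  · rw [← probReal_compl_eq_one_sub₀ (nullMeasurableSet_lt hγ aemeasurable_const)]
    congr 1
    ext ω
    simp
  · rw [hcdf]
    exact CRNoma.Network.one_sub_integral_gammaTail_level hA
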